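/- Fix $d$. A bipartite pure state is a unit vector $|\phi\rangle=\sum_{ij}a_{ij}|i\rangle|j\rangle\in\mathbb C^d\otimes\mathbb C^d$, with G-concurrence $G(|\phi\rangle)=d\,[\det(A^\dagger A)]^{1/d}$, $A=(a_{ij})$; for a density matrix $\sigma$ on $\mathbb C^d\otimes\mathbb C^d$, $G(\sigma)=\min\sum_i p_iG(|\phi_i\rangle)$ over all finite decompositions $\sigma=\sum_i p_i|\phi_i\rangle\langle\phi_i|$ into pure states. For a pure state $|\psi\rangle\in\mathbb C^d\otimes\mathbb C^d\otimes\mathbb C^n$ of Alice, Bob and Sapna, the G-concurrence of assistance is $$G_a(|\psi\rangle)=\max\sum_i p_iG(|\phi_i\rangle),$$ over all finite decompositions $\mathrm{Tr}_S|\psi\rangle\langle\psi|=\sum_i p_i|\phi_i\rangle\langle\phi_i|$ into pure states, and for a mixed state $\rho$ on $\mathbb C^d\otimes\mathbb C^d\otimes\mathbb C^n$ it is $G_a(\rho)=\min\sum_jq_jG_a(|\psi_j\rangle)$ over all finite decompositions $\rho=\sum_jq_j|\psi_j\rangle\langle\psi_j|$ into pure states. The assisted G-concurrence $A_G(\rho)$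 is the maximum of $\sum_kp_kG(\sigma_k)$ over all ensembles $\{p_k,\sigma_k\}$ of $d\times d$ states that Alice and Bob can share after a tripartite LOCC protocol applied to $\rho$: finitely many rounds, in each of which one party applies a local quantum instrument with finitely many Kraus operators (the local dimension may change) and announces the outcome, the later rounds being allowed to depend on it. Theorem 1. The maxima and minima defining $G$ and $G_a$ are attained, $G_a(|\psi\rangle\langle\psi|)=G_a(|\psi\rangle)$ for every pure state, and $G_a$ is an entanglement monotone on tripartite mixed states, that is: (i) For every mixed state $\rho$ on $\mathbb C^d\otimes\mathbb C^d\otimes\mathbb C^n$ and every quantum operation $\varepsilon_k(\rho)=\sum_jM_{k,j}\rho M_{k,j}^\dagger$ (finitely many $k,j$) performed locally by Alice, by Bob or by Sapna, where the $M_{k,j}$ act on the system of that party and $\sum_{k,j}M_{k,j}^\dagger M_{k,j}\le I$, $$G_a(\rho)\ \ge\ \sum_kp_k\,G_a(\rho_k),\qquad p_k=\mathrm{Tr}\,\varepsilon_k(\rho),\quad \rho_k=\varepsilon_k(\rho)/p_k,$$ where terms with $p_k=0$ are omitted; the operators of Alice and Bob are $d\times d$, those of Sapna may have any output dimension depending on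 $k$. (ii) $G_a$ is a convex function on the set of density matrices on $\mathbb C^d\otimes\mathbb C^d\otimes\mathbb C^n$, for every $n$. Consequently, for every pure state $|\psi\rangle\in\mathbb C^d\otimes\mathbb C^d\otimes\mathbb C^n$ the maximum defining $A_G$ is attained, $A_G(|\psi\rangle\langle\psi|)=G_a(|\psi\rangle)$, and this value is attained by a protocol that consists of a single measurement by Sapna. -/

import Mathlib

open scoped Kronecker ComplexOrder

noncomputable section

/-- A (not necessarily normalized) operator on the Hilbert space `ℂ^a ⊗ ℂ^b ⊗ ℂ^s` of
Alice, Bob and Sapna, as a matrix in the product basis. -/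
abbrev TripartiteOp (a b s : ℕ) : Type :=
  Matrix (Fin a × Fin b × Fin s) (Fin a × Fin b × Fin s) ℂ

/-- An operator on the Hilbert space `ℂ^a ⊗ ℂ^b` of Alice and Bob. -/
abbrev BipartiteOp (a b : ℕ) : Type :=
  Matrix (Fin a × Fin b) (Fin a × Fin b) ℂ

/-- Density matrices. -/
def IsState {ι : Type} [Fintype ι] (ρ : Matrix ι ι ℂ) : Prop :=
  ρ.PosSemidef ∧ ρ.trace = 1

/-- State vectors normalized in the Hilbert space norm. -/
def IsUnitVector {ι : Type} [Fintype ι] (ψ : ι → ℂ) : Prop :=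
  ∑ x, ‖ψ x‖ ^ 2 = 1

/-- The projector `|ψ⟩⟨ψ|`. -/
def pureState {ι : Type} (ψ : ι → ℂ) : Matrix ι ι ℂ :=
  Matrix.vecMulVec ψ (star ψ)

/-- The partial trace over Sapna's system. -/
def reducedAB {a b s : ℕ} (ρ : TripartiteOp a b s) : BipartiteOp a b :=
  Matrix.of fun x y => ∑ k, ρ (x.1, x.2, k) (y.1, y.2, k)

/-- The averages `∑ pᵢ f(φᵢ)` over all finite decompositions `ρ = ∑ pᵢ |φᵢ⟩⟨φᵢ|` of `ρ` into
pure states. -/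
def ensembleAverages {ι : Type} [Fintype ι] (f : (ι → ℂ) → ℝ) (ρ : Matrix ι ι ℂ) : Set ℝ :=
  {x | ∃ (m : ℕ) (p : Fin m → ℝ) (φ : Fin m → ι → ℂ),
    (∀ i, 0 ≤ p i) ∧ ∑ i, p i = 1 ∧ (∀ i, IsUnitVector (φ i)) ∧
    ρ = ∑ i, p i • pureState (φ i) ∧ x = ∑ i, p i * f (φ i)}

/-- The G-concurrence `d [det (A†A)]^(1/d)` of the vector `∑ A i j |i⟩|j⟩`. -/
def gConcurrencePure {d : ℕ} (φ : Fin d × Fin d → ℂ) : ℝ :=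
  let A : Matrix (Fin d) (Fin d) ℂ := Matrix.of fun i j => φ (i, j)
  d * ((A.conjTranspose * A).det.re) ^ (1 / (d : ℝ))

/-- The G-concurrence of a bipartite mixed state (convex roof). -/
def gConcurrence {d : ℕ} (σ : BipartiteOp d d) : ℝ :=
  sInf (ensembleAverages gConcurrencePure σ)

/-- The G-concurrence of assistance of a pure tripartite state: the maximal average
G-concurrence over the decompositions of the reduced state of Alice and Bob. -/
def gAssistancePure {d n : ℕ} (ψ : Fin d × Fin d × Fin n → ℂ) : ℝ :=
  sSup (ensembleAverages gConcurrencePure (reducedAB (pureState ψ)))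

/-- The G-concurrence of assistance of a tripartite mixed state (convex roof). -/
def gAssistance {d n : ℕ} (ρ : TripartiteOp d d n) : ℝ :=
  sInf (ensembleAverages gAssistancePure ρ)

/-- The probability of an unnormalized state. -/
def prob {ι : Type} [Fintype ι] (ρ : Matrix ι ι ℂ) : ℝ := ρ.trace.re

/-- The normalized state `ρ / Tr ρ`; where `Tr ρ = 0` the value is irrelevant, as it only ever
occurs with the weight `prob ρ = 0`. -/
def normalized {ι : Type} [Fintype ι] (ρ : Matrix ι ι ℂ) : Matrix ι ι ℂ := (prob ρ)⁻¹ • ρ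

/-- Alice applies the completely positive map with Kraus operators `M j`. -/
def aliceOp {a b s a' J : ℕ} (M : Fin J → Matrix (Fin a') (Fin a) ℂ) (ρ : TripartiteOp a b s) :
    TripartiteOp a' b s :=
  ∑ j, (M j ⊗ₖ (1 : Matrix (Fin b × Fin s) (Fin b × Fin s) ℂ)) * ρ *
    (M j ⊗ₖ (1 : Matrix (Fin b × Fin s) (Fin b × Fin s) ℂ)).conjTranspose

/-- Bob applies the completely positive map with Kraus operators `M j`. -/
def bobOp {a b s b' J : ℕ} (M : Fin J → Matrix (Fin b') (Fin b) ℂ) (ρ : TripartiteOp a b s) :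
    TripartiteOp a b' s :=
  ∑ j, ((1 : Matrix (Fin a) (Fin a) ℂ) ⊗ₖ (M j ⊗ₖ (1 : Matrix (Fin s) (Fin s) ℂ))) * ρ *
    ((1 : Matrix (Fin a) (Fin a) ℂ) ⊗ₖ (M j ⊗ₖ (1 : Matrix (Fin s) (Fin s) ℂ))).conjTranspose

/-- Sapna applies the completely positive map with Kraus operators `M j`. -/
def sapnaOp {a b s s' J : ℕ} (M : Fin J → Matrix (Fin s') (Fin s) ℂ) (ρ : TripartiteOp a b s) :
    TripartiteOp a b s' :=
  ∑ j, ((1 : Matrix (Fin a) (Fin a) ℂ) ⊗ₖ ((1 : Matrix (Fin b) (Fin b) ℂ) ⊗ₖ M j)) * ρ *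
    ((1 : Matrix (Fin a) (Fin a) ℂ) ⊗ₖ ((1 : Matrix (Fin b) (Fin b) ℂ) ⊗ₖ M j)).conjTranspose

/-- The Kraus operators `M k j` (outcome `k` with output dimension `c' k`, unobserved index `j`)
satisfy `∑ M† M ≤ 1`, so that `k` labels the outcomes of a quantum operation. -/
def IsOperation {c K J : ℕ} {c' : Fin K → ℕ} (M : ∀ k, Fin J → Matrix (Fin (c' k)) (Fin c) ℂ) :
    Prop :=
  (1 - ∑ k, ∑ j, (M k j).conjTranspose * M k j).PosSemidef

/-- The Kraus operators `M k j` satisfy `∑ M† M = 1`: the outcome probabilities sum to one. -/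
def IsInstrument {c K J : ℕ} {c' : Fin K → ℕ} (M : ∀ k, Fin J → Matrix (Fin (c' k)) (Fin c) ℂ) :
    Prop :=
  ∑ k, ∑ j, (M k j).conjTranspose * M k j = 1

/-- Entanglement monotones on tripartite `d × d × n` mixed states, `n` arbitrary:
convex functions of the state that do not increase on average under a local quantum operation
by Alice, by Bob or by Sapna. -/
structure IsEntanglementMonotone (d : ℕ) (E : ∀ n : ℕ, TripartiteOp d d n → ℝ) : Prop where
  alice : ∀ (n : ℕ) (ρ : TripartiteOp d d n), IsState ρ →
    ∀ (K J : ℕ) (M : Fin K → Fin J → Matrix (Fin d) (Fin d) ℂ), IsOperation M →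
      ∑ k, prob (aliceOp (M k) ρ) * E n (normalized (aliceOp (M k) ρ)) ≤ E n ρ
  bob : ∀ (n : ℕ) (ρ : TripartiteOp d d n), IsState ρ →
    ∀ (K J : ℕ) (M : Fin K → Fin J → Matrix (Fin d) (Fin d) ℂ), IsOperation M →
      ∑ k, prob (bobOp (M k) ρ) * E n (normalized (bobOp (M k) ρ)) ≤ E n ρ
  sapna : ∀ (n : ℕ) (ρ : TripartiteOp d d n), IsState ρ →
    ∀ (K J : ℕ) (n' : Fin K → ℕ) (M : ∀ k, Fin J → Matrix (Fin (n' k)) (Fin n) ℂ),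
      IsOperation M →
      ∑ k, prob (sapnaOp (M k) ρ) * E (n' k) (normalized (sapnaOp (M k) ρ)) ≤ E n ρ
  convex : ∀ n : ℕ, ConvexOn ℝ {ρ : TripartiteOp d d n | IsState ρ} (E n)

/-- Tripartite LOCC protocols that start on `ℂ^a ⊗ ℂ^b ⊗ ℂ^s` and leave Alice and Bob with a
`d × d` system. In each round one party applies an instrument to her or his own system (whose
dimension may change, so that ancillas and local memory are allowed) and announces the
outcome `k`, on which the rest of the protocol may depend. -/
inductive LOCC (d : ℕ) : ℕ → ℕ → ℕ → Type
  | finish {s : ℕ} : LOCC d d d s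
  | alice {a b s K J : ℕ} {a' : Fin K → ℕ} (M : ∀ k, Fin J → Matrix (Fin (a' k)) (Fin a) ℂ)
      (hM : IsInstrument M) (next : ∀ k, LOCC d (a' k) b s) : LOCC d a b s
  | bob {a b s K J : ℕ} {b' : Fin K → ℕ} (M : ∀ k, Fin J → Matrix (Fin (b' k)) (Fin b) ℂ)
      (hM : IsInstrument M) (next : ∀ k, LOCC d a (b' k) s) : LOCC d a b s
  | sapna {a b s K J : ℕ} {s' : Fin K → ℕ} (M : ∀ k, Fin J → Matrix (Fin (s' k)) (Fin s) ℂ)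
      (hM : IsInstrument M) (next : ∀ k, LOCC d a b (s' k)) : LOCC d a b s

/-- The final states of Alice and Bob, one for each sequence of outcomes, each unnormalized with
trace equal to its probability. -/
def LOCC.outcomes {d : ℕ} : {a b s : ℕ} → LOCC d a b s → TripartiteOp a b s →
    List (BipartiteOp d d)
  | _, _, _, .finish, ρ => [reducedAB ρ]
  | _, _, _, .alice M _ next, ρ =>
      (List.ofFn fun k => (next k).outcomes (aliceOp (M k) ρ)).flatten
  | _, _, _, .bob M _ next, ρ =>
      (List.ofFn fun k => (next k).outcomes (bobOp (M k) ρ)).flatten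
  | _, _, _, .sapna M _ next, ρ =>
      (List.ofFn fun k => (next k).outcomes (sapnaOp (M k) ρ)).flatten

/-- The average `∑ pₖ G(σₖ)` of the G-concurrence that Alice and Bob share after the protocol. -/
def LOCC.averageG {d a b s : ℕ} (P : LOCC d a b s) (ρ : TripartiteOp a b s) : ℝ :=
  ((P.outcomes ρ).map fun σ => prob σ * gConcurrence (normalized σ)).sum

/-- The assisted G-concurrence: the maximal average G-concurrence of Alice and Bob after a
tripartite LOCC protocol. -/
def assistedG {d n : ℕ} (ρ : TripartiteOp d d n) : ℝ :=
  sSup (Set.range fun P : LOCC d d d n => P.averageG ρ)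

end

/-! The quantity det(A†A)^(1/d), here `gramRoot`, is multiplicative, so a local operator A ⊗ B
multiplies the G-concurrence of every bipartite vector by the same factor `gramRoot A * gramRoot B`.
By the arithmetic-geometric mean inequality the factors of one local operation sum to at most 1
(`sum_gramRoot_mul_le`).

All functions involved are homogeneous of degree two, so probabilities are absorbed into
unnormalized vectors. Every decomposition ∑ |φᵢ⟩⟨φᵢ| of the reduced state comes from the slices
⟨k|ψ⟩ by a coisometry (`exists_coisometry_of_sum_pureState_eq`, the Hughston–Jozsa–Wootters
theorem), that is, from a measurement of Sapna. Pulled back through A ⊗ B, this bounds the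
assistance after an action of Alice or Bob (`assistance_local_mulVec_le`). Sapna's own operations
only produce further decompositions of part of the same reduced state
(`sum_assistance_sapna_mulVec_le`). An optimal decomposition of a mixed state carries both bounds
over to the convex roof; convexity is the mixing of two optimal decompositions.

Minima and maxima are attained because the convex hull of a compact piece of an epigraph is compact.
For the roof of the assistance this needs lower semicontinuity, which holds since the assistance is
a supremum of continuous functions, one for each coisometry.

In an LOCC protocol the local dimensions may change, so monotonicity on d × d × n states cannot be
iterated. Instead `LOCC.averageG_le` follows vectors (Aₗ ⊗ Bₗ ⊗ 1) ψₗ with Aₗ, Bₗ rectangular with d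
columns and ψₗ still on d × d × s, and bounds the yield by induction. The coisometry of an optimal
decomposition, read as a measurement, reaches the bound. -/

noncomputable section AssistedConcurrence

open Matrix

/-! ### Compactness of convex hulls -/

/-- The convex hull of a compact set in a finite-dimensional space is compact. -/
theorem IsCompact.isCompact_convexHull {E : Type*} [AddCommGroup E] [Module ℝ E]
    [FiniteDimensional ℝ E] [TopologicalSpace E] [ContinuousAdd E] [ContinuousSMul ℝ E]
    {s : Set E} (hs : IsCompact s) : IsCompact (convexHull ℝ s) := by
  rcases s.eq_empty_or_nonempty with rfl | ⟨z₀, hz₀⟩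
  · simp
  let N := Module.finrank ℝ E + 1
  let F : (Fin N → ℝ) × (Fin N → E) → E := fun q => ∑ i, q.1 i • q.2 i
  have hF : Continuous F := by fun_prop
  have hK : IsCompact (stdSimplex ℝ (Fin N) ×ˢ Set.univ.pi fun _ : Fin N => s) :=
    (isCompact_stdSimplex _ _).prod (isCompact_univ_pi fun _ => hs)
  convert hK.image hF using 1
  ext x
  constructor
  · intro hx
    -- Carathéodory: affinely independent points number at most `finrank + 1`, so the fixed index
    -- type `Fin N` serves every point of the hull.
    obtain ⟨ι, _, z, w, hz, hind, hw, hw1, hx⟩ := eq_pos_convex_span_of_mem_convexHull hx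
    have hcard : Fintype.card ι ≤ Fintype.card (Fin N) := by
      have := hind.card_le_finrank_succ
      have h2 := Submodule.finrank_le (vectorSpan ℝ (Set.range z))
      simp only [Fintype.card_fin, N]
      omega
    obtain ⟨e⟩ := Function.Embedding.nonempty_of_card_le hcard
    have he := e.injective
    -- Unused indices get weight 0 and the default point `z₀`, which keeps the tuple inside `s`.
    refine ⟨(Function.extend e w 0, Function.extend e z fun _ => z₀), ⟨⟨?_, ?_⟩, ?_⟩, ?_⟩
    · intro i
      by_cases hi : ∃ j, e j = i
      · obtain ⟨j, rfl⟩ := hi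
        simpa [he.extend_apply] using (hw j).le
      · simp [Function.extend_apply' _ _ _ hi]
    · rw [← hw1]
      refine (Fintype.sum_of_injective e he _ _ (fun i hi => ?_) fun i => ?_).symm
      · have : Function.extend e w 0 i = 0 := Function.extend_apply' _ _ _ hi
        simp [this]
      · simp [he.extend_apply]
    · intro i _
      by_cases hi : ∃ j, e j = i
      · obtain ⟨j, rfl⟩ := hi
        simpa [he.extend_apply] using hz ⟨j, rfl⟩
      · simpa [Function.extend_apply' _ _ _ hi] using hz₀
    · rw [← hx]
      refine (Fintype.sum_of_injective e he _ _ (fun i hi => ?_) fun i => ?_).symm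
      · have : Function.extend e w 0 i = 0 := Function.extend_apply' _ _ _ hi
        simp [this]
      · simp [he.extend_apply]
  · rintro ⟨⟨w, z⟩, ⟨⟨hw, hw1⟩, hz⟩, rfl⟩
    exact mem_convexHull_of_exists_fintype w z hw hw1 (fun i => hz i trivial) rfl

/-! ### Rank-one operators and traces -/

section pure

variable {ι κ : Type}

theorem pureState_apply (φ : ι → ℂ) (x y : ι) : pureState φ x y = φ x * star (φ y) := rfl

theorem pureState_smul (c : ℂ) (φ : ι → ℂ) : pureState (c • φ) = (‖c‖ ^ 2 : ℝ) • pureState φ := by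
  ext x y
  have : c * star c = ((‖c‖ ^ 2 : ℝ) : ℂ) := by
    simpa using Complex.mul_conj' c
  simp only [pureState_apply, Pi.smul_apply, smul_eq_mul, star_mul', Matrix.smul_apply,
    Complex.real_smul, ← this]
  ring

theorem pureState_zero : pureState (0 : ι → ℂ) = 0 := by
  ext; simp [pureState_apply]

theorem pureState_mulVec [Fintype ι] (T : Matrix κ ι ℂ) (φ : ι → ℂ) :
    pureState (T *ᵥ φ) = T * pureState φ * Tᴴ := by
  rw [pureState, pureState, mul_vecMulVec, vecMulVec_mul, star_mulVec]

theorem continuous_pureState : Continuous (pureState : (ι → ℂ) → Matrix ι ι ℂ) := by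
  refine continuous_matrix fun x y => ?_
  simp only [pureState_apply]
  fun_prop

variable [Fintype ι] [Fintype κ]

theorem prob_pureState (φ : ι → ℂ) : prob (pureState φ) = ∑ x, ‖φ x‖ ^ 2 := by
  simp only [prob, trace, diag_apply, pureState_apply, Complex.re_sum]
  refine Finset.sum_congr rfl fun x _ => ?_
  have : φ x * star (φ x) = ((‖φ x‖ ^ 2 : ℝ) : ℂ) := by
    simpa using Complex.mul_conj' (φ x)
  rw [this, Complex.ofReal_re]

theorem isUnitVector_iff {φ : ι → ℂ} : IsUnitVector φ ↔ prob (pureState φ) = 1 := by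
  rw [prob_pureState, IsUnitVector]

theorem prob_pureState_nonneg (φ : ι → ℂ) : 0 ≤ prob (pureState φ) := by
  rw [prob_pureState]; positivity

theorem prob_pureState_eq_zero {φ : ι → ℂ} : prob (pureState φ) = 0 ↔ φ = 0 := by
  rw [prob_pureState, Finset.sum_eq_zero_iff_of_nonneg fun _ _ => by positivity]
  simp [funext_iff]

theorem prob_sum (ρ : κ → Matrix ι ι ℂ) : prob (∑ k, ρ k) = ∑ k, prob (ρ k) := by
  simp [prob, trace_sum]

theorem prob_add (ρ σ : Matrix ι ι ℂ) : prob (ρ + σ) = prob ρ + prob σ := by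
  simp [prob]

theorem prob_smul (r : ℝ) (ρ : Matrix ι ι ℂ) : prob (r • ρ) = r * prob ρ := by
  simp [prob, trace_smul]

theorem posSemidef_pureState (φ : ι → ℂ) : (pureState φ).PosSemidef :=
  posSemidef_vecMulVec_self_star φ

theorem posSemidef_sum_pureState (φ : κ → ι → ℂ) : (∑ k, pureState (φ k)).PosSemidef :=
  posSemidef_sum _ fun k _ => posSemidef_pureState (φ k)

theorem Matrix.PosSemidef.exists_eq_sum_pureState {ρ : Matrix ι ι ℂ} (h : ρ.PosSemidef) :
    ∃ (m : ℕ) (φ : Fin m → ι → ℂ), ρ = ∑ k, pureState (φ k) :=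
  posSemidef_iff_eq_sum_vecMulVec.1 h

theorem Matrix.PosSemidef.prob_eq {ρ : Matrix ι ι ℂ} (h : ρ.PosSemidef) :
    ρ.trace = (prob ρ : ℂ) := by
  have := h.trace_nonneg
  rw [Complex.nonneg_iff] at this
  exact Complex.ext rfl (by simpa using this.2.symm)

theorem isState_iff {ρ : Matrix ι ι ℂ} : IsState ρ ↔ ρ.PosSemidef ∧ prob ρ = 1 := by
  refine and_congr_right fun h => ?_
  rw [h.prob_eq]
  norm_cast

theorem normalized_of_prob_eq_one {ρ : Matrix ι ι ℂ} (h : prob ρ = 1) : normalized ρ = ρ := by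
  simp [normalized, h]

end pure

/-! ### Ensemble averages and convex roofs -/

section averages

variable {ι κ : Type}

/-- Functions that scale like the trace of `pureState φ`. -/
def IsQuadraticallyHomogeneous (f : (ι → ℂ) → ℝ) : Prop :=
  ∀ (c : ℂ) (φ : ι → ℂ), f (c • φ) = ‖c‖ ^ 2 * f φ

theorem IsQuadraticallyHomogeneous.map_zero {f : (ι → ℂ) → ℝ}
    (hf : IsQuadraticallyHomogeneous f) : f 0 = 0 := by
  simpa using hf 0 0

variable [Fintype ι] [Fintype κ]

theorem mem_ensembleAverages_of_fintype {f : (ι → ℂ) → ℝ} {ρ : Matrix ι ι ℂ} (p : κ → ℝ)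
    (φ : κ → ι → ℂ) (hp : ∀ k, 0 ≤ p k) (hp1 : ∑ k, p k = 1) (hφ : ∀ k, IsUnitVector (φ k))
    (hρ : ρ = ∑ k, p k • pureState (φ k)) : ∑ k, p k * f (φ k) ∈ ensembleAverages f ρ := by
  let e := (Fintype.equivFin κ).symm
  refine ⟨_, p ∘ e, φ ∘ e, fun i => hp _, ?_, fun i => hφ _, ?_, ?_⟩
  · rw [← hp1]; exact e.sum_comp p
  · rw [hρ]; exact (e.sum_comp fun k => p k • pureState (φ k)).symm
  · exact (e.sum_comp fun k => p k * f (φ k)).symm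

theorem ensembleAverages_congr {f f' : (ι → ℂ) → ℝ} (h : ∀ φ, IsUnitVector φ → f φ = f' φ)
    (ρ : Matrix ι ι ℂ) : ensembleAverages f ρ = ensembleAverages f' ρ := by
  ext x
  refine exists_congr fun m => exists_congr fun p => exists_congr fun φ => ?_
  refine and_congr_right fun _ => and_congr_right fun _ => and_congr_right fun hφ =>
    and_congr_right fun _ => ?_
  simp only [fun i => h _ (hφ i)]

theorem exists_decomposition_of_mem_ensembleAverages {f : (ι → ℂ) → ℝ}
    (hf : IsQuadraticallyHomogeneous f) {ρ : Matrix ι ι ℂ} {x : ℝ}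
    (hx : x ∈ ensembleAverages f ρ) :
    ∃ (m : ℕ) (φ : Fin m → ι → ℂ), ρ = ∑ k, pureState (φ k) ∧ x = ∑ k, f (φ k) := by
  obtain ⟨m, p, φ, hp, -, -, rfl, rfl⟩ := hx
  have key : ∀ k, ‖((√(p k) : ℝ) : ℂ)‖ ^ 2 = p k := fun k => by
    rw [Complex.norm_real, Real.norm_eq_abs, sq_abs, Real.sq_sqrt (hp k)]
  refine ⟨m, fun k => ((√(p k) : ℝ) : ℂ) • φ k, ?_, ?_⟩
  · simp only [pureState_smul, key]
  · simp only [hf _ _, key]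

theorem average_mem_ensembleAverages {f : (ι → ℂ) → ℝ}
    (hf : IsQuadraticallyHomogeneous f) {ρ : Matrix ι ι ℂ} (φ : κ → ι → ℂ)
    (hρ : ρ = ∑ k, pureState (φ k)) (hpos : 0 < prob ρ) :
    (prob ρ)⁻¹ * ∑ k, f (φ k) ∈ ensembleAverages f (normalized ρ) := by
  classical
  have hsum : ∑ k, prob (pureState (φ k)) = prob ρ := by rw [hρ, prob_sum]
  have key : ∀ v : ι → ℂ, v ≠ 0 → ∃ u, IsUnitVector u ∧
      v = ((√(prob (pureState v)) : ℝ) : ℂ) • u := by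
    intro v hv
    have h0 : prob (pureState v) ≠ 0 := fun h => hv (prob_pureState_eq_zero.1 h)
    have h1 : √(prob (pureState v)) ≠ 0 := by
      rwa [Ne, Real.sqrt_eq_zero (prob_pureState_nonneg v)]
    refine ⟨((√(prob (pureState v)))⁻¹ : ℂ) • v, ?_, ?_⟩
    · rw [isUnitVector_iff, pureState_smul, prob_smul, norm_inv, Complex.norm_real,
        Real.norm_eq_abs, inv_pow, sq_abs, Real.sq_sqrt (prob_pureState_nonneg v),
        inv_mul_cancel₀ h0]
    · rw [smul_smul, mul_inv_cancel₀ (by exact_mod_cast h1), one_smul]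
  -- A zero vector has weight 0 but still has to be assigned a unit vector; the normalization of
  -- some nonzero term, which exists as the trace is positive, serves for all of them.
  obtain ⟨k₀, hk₀⟩ : ∃ k, φ k ≠ 0 := by
    by_contra! h
    simp [h, pureState_zero] at hρ
    simp [hρ, prob] at hpos
  obtain ⟨u₀, hu₀, -⟩ := key _ hk₀
  have key' : ∀ k, ∃ u, IsUnitVector u ∧ φ k = ((√(prob (pureState (φ k))) : ℝ) : ℂ) • u := by
    intro k
    by_cases h : φ k = 0
    · exact ⟨u₀, hu₀, by simp [h, pureState_zero, prob]⟩
    · exact key _ h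
  choose u hu hφ using key'
  have hnorm : ∀ k, ‖((√(prob (pureState (φ k))) : ℝ) : ℂ)‖ ^ 2 = prob (pureState (φ k)) :=
    fun k => by
      rw [Complex.norm_real, Real.norm_eq_abs, sq_abs, Real.sq_sqrt (prob_pureState_nonneg _)]
  have hpure : ∀ k, pureState (φ k) = prob (pureState (φ k)) • pureState (u k) := fun k => by
    conv_lhs => rw [hφ k, pureState_smul, hnorm]
  have hfφ : ∀ k, f (φ k) = prob (pureState (φ k)) * f (u k) := fun k => by
    conv_lhs => rw [hφ k, hf, hnorm]
  have := mem_ensembleAverages_of_fintype (f := f) (ρ := normalized ρ)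
    (fun k => (prob ρ)⁻¹ * prob (pureState (φ k))) u
    (fun k => mul_nonneg (inv_nonneg.2 hpos.le) (prob_pureState_nonneg _))
    (by rw [← Finset.mul_sum, hsum, inv_mul_cancel₀ hpos.ne']) hu
    (by
      simp only [mul_smul, ← hpure]
      rw [← Finset.smul_sum, ← hρ, normalized])
  convert this using 1
  rw [Finset.mul_sum]
  exact Finset.sum_congr rfl fun k _ => by rw [hfφ k, mul_assoc]

theorem sum_mem_ensembleAverages {f : (ι → ℂ) → ℝ}
    (hf : IsQuadraticallyHomogeneous f) {ρ : Matrix ι ι ℂ} (φ : κ → ι → ℂ)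
    (hρ : ρ = ∑ k, pureState (φ k)) (h1 : prob ρ = 1) :
    ∑ k, f (φ k) ∈ ensembleAverages f ρ := by
  simpa [h1, normalized_of_prob_eq_one h1] using
    average_mem_ensembleAverages hf φ hρ (h1 ▸ one_pos)

theorem ensembleAverages_nonneg {f : (ι → ℂ) → ℝ} (h0 : ∀ φ, 0 ≤ f φ) {ρ : Matrix ι ι ℂ} {x : ℝ}
    (hx : x ∈ ensembleAverages f ρ) : 0 ≤ x := by
  obtain ⟨m, p, φ, hp, -, -, -, rfl⟩ := hx
  exact Finset.sum_nonneg fun i _ => mul_nonneg (hp i) (h0 _)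

/-- The convex roof of a nonnegative function, weighted with the probability, is bounded by the
value on any decomposition. -/
theorem prob_mul_sInf_ensembleAverages_le {f : (ι → ℂ) → ℝ}
    (hf : IsQuadraticallyHomogeneous f) (h0 : ∀ φ, 0 ≤ f φ) {ρ : Matrix ι ι ℂ} (φ : κ → ι → ℂ)
    (hρ : ρ = ∑ k, pureState (φ k)) :
    prob ρ * sInf (ensembleAverages f (normalized ρ)) ≤ ∑ k, f (φ k) := by
  have hnn : 0 ≤ prob ρ := by
    rw [hρ, prob_sum]; exact Finset.sum_nonneg fun k _ => prob_pureState_nonneg _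
  rcases hnn.eq_or_lt with h | h
  · rw [← h, zero_mul]
    exact Finset.sum_nonneg fun k _ => h0 _
  · have := csInf_le ⟨0, fun x hx => ensembleAverages_nonneg h0 hx⟩
      (average_mem_ensembleAverages hf φ hρ h)
    calc _ ≤ prob ρ * ((prob ρ)⁻¹ * ∑ k, f (φ k)) := by gcongr
      _ = _ := mul_inv_cancel_left₀ h.ne' _

theorem ensembleAverages_nonempty {f : (ι → ℂ) → ℝ} (hf : IsQuadraticallyHomogeneous f)
    {ρ : Matrix ι ι ℂ} (hρ : IsState ρ) : (ensembleAverages f ρ).Nonempty := by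
  obtain ⟨m, φ, h⟩ := hρ.1.exists_eq_sum_pureState
  exact ⟨_, sum_mem_ensembleAverages hf φ h (isState_iff.1 hρ).2⟩

/-- The convex roof of a lower semicontinuous function is attained. -/
theorem isLeast_sInf_ensembleAverages {f : (ι → ℂ) → ℝ} (hf : IsQuadraticallyHomogeneous f)
    (hlsc : LowerSemicontinuous f) {C : ℝ} (hC : ∀ φ, IsUnitVector φ → |f φ| ≤ C)
    {ρ : Matrix ι ι ℂ} (hρ : IsState ρ) :
    IsLeast (ensembleAverages f ρ) (sInf (ensembleAverages f ρ)) := by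
  -- The graph of `f` need not be closed, but the epigraph is, by lower semicontinuity; cutting it
  -- at `C` makes it compact. The fibre of its convex hull over `ρ` then has a least element.
  set S : Set (Matrix ι ι ℂ × ℝ) := (fun q : (ι → ℂ) × ℝ => (pureState q.1, q.2)) ''
    {q | IsUnitVector q.1 ∧ f q.1 ≤ q.2 ∧ q.2 ≤ C}
  have hSc : IsCompact S := by
    refine IsCompact.image ?_ ((continuous_pureState.comp continuous_fst).prodMk continuous_snd)
    have hK : IsCompact ((Set.univ.pi fun _ : ι => Metric.closedBall (0 : ℂ) 1) ×ˢ
        Set.Icc (-C) C) :=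
      (isCompact_univ_pi fun _ => isCompact_closedBall _ _).prod isCompact_Icc
    refine hK.of_isClosed_subset ?_ ?_
    · refine IsClosed.inter ?_ (IsClosed.inter hlsc.isClosed_epigraph ?_)
      · exact isClosed_eq (f := fun q : (ι → ℂ) × ℝ => ∑ x, ‖q.1 x‖ ^ 2) (by fun_prop)
          continuous_const
      · exact isClosed_le continuous_snd continuous_const
    · rintro ⟨φ, t⟩ ⟨h1, h2, h3⟩
      refine ⟨fun x _ => ?_, (neg_le_of_abs_le (hC φ h1)).trans h2, h3⟩
      simp only [Metric.mem_closedBall, dist_zero_right]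
      have : ‖φ x‖ ^ 2 ≤ ∑ x, ‖φ x‖ ^ 2 :=
        Finset.single_le_sum (f := fun x => ‖φ x‖ ^ 2) (fun _ _ => by positivity)
          (Finset.mem_univ x)
      rw [h1] at this
      exact (sq_le_one_iff₀ (norm_nonneg _)).1 this
  have hT : IsCompact {t : ℝ | (ρ, t) ∈ convexHull ℝ S} := by
    have := (hSc.isCompact_convexHull.inter_right
      (isClosed_eq continuous_fst (continuous_const (y := ρ)))).image continuous_snd
    convert this using 1
    ext t
    constructor
    · intro h
      exact ⟨(ρ, t), ⟨h, rfl⟩, rfl⟩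
    · rintro ⟨⟨ρ', t'⟩, ⟨h, h'⟩, rfl⟩
      obtain rfl : ρ' = ρ := h'
      exact h
  have hsub : ensembleAverages f ρ ⊆ {t : ℝ | (ρ, t) ∈ convexHull ℝ S} := by
    rintro x ⟨m, p, φ, hp, hp1, hφ, rfl, rfl⟩
    refine mem_convexHull_of_exists_fintype p (fun i => (pureState (φ i), f (φ i))) hp hp1
      (fun i => ⟨(φ i, f (φ i)), ⟨hφ i, le_rfl, le_of_abs_le (hC _ (hφ i))⟩, rfl⟩) ?_
    ext1
    · simp [Prod.fst_sum]
    · simp [Prod.snd_sum]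
  obtain ⟨x₀, hx₀⟩ := ensembleAverages_nonempty hf hρ
  obtain ⟨t, ht⟩ := hT.exists_isLeast ⟨x₀, hsub hx₀⟩
  obtain ⟨κ, _, w, z, hw, hw1, hz, hx⟩ := mem_convexHull_iff_exists_fintype.1 ht.1
  choose q hq hqz using hz
  have hmem : ∑ k, w k * f (q k).1 ∈ ensembleAverages f ρ := by
    refine mem_ensembleAverages_of_fintype w _ hw hw1 (fun k => (hq k).1) ?_
    have := congrArg Prod.fst hx
    simp only [Prod.fst_sum, Prod.smul_fst, ← hqz] at this
    exact this.symm
  -- Replacing the heights in the epigraph by the values of `f` only lowers the average, so the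
  -- minimum over the hull is a genuine ensemble average.
  have hle : ∑ k, w k * f (q k).1 ≤ t := by
    have := congrArg Prod.snd hx
    simp only [Prod.snd_sum, Prod.smul_snd, ← hqz, smul_eq_mul] at this
    rw [← this]
    exact Finset.sum_le_sum fun k _ => mul_le_mul_of_nonneg_left (hq k).2.1 (hw k)
  have hL : IsLeast (ensembleAverages f ρ) (∑ k, w k * f (q k).1) :=
    ⟨hmem, fun y hy => hle.trans (ht.2 (hsub hy))⟩
  rwa [hL.csInf_eq]

end averages

/-! ### Unitary freedom of decompositions -/

section steering

variable {ι κ μ : Type} [Fintype ι] [Fintype κ] [Fintype μ]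

theorem sum_norm_sq_dotProduct_of_sum_pureState (ξ : κ → ι → ℂ) (x : ι → ℂ) :
    ((∑ k, ‖star (ξ k) ⬝ᵥ x‖ ^ 2 : ℝ) : ℂ) = star x ⬝ᵥ ((∑ k, pureState (ξ k)) *ᵥ x) := by
  rw [sum_mulVec, dotProduct_sum]
  push_cast
  refine Finset.sum_congr rfl fun k _ => ?_
  rw [pureState, vecMulVec_mulVec, ← Complex.mul_conj']
  simp only [op_smul_eq_smul, dotProduct_smul, smul_eq_mul]
  congr 1
  rw [← Complex.star_def, star_dotProduct, star_star]

/-- Two decompositions of the same operator into rank-one projectors are related by a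
coisometry. -/
theorem exists_coisometry_of_sum_pureState_eq [DecidableEq κ] (ξ : κ → ι → ℂ) (φ : μ → ι → ℂ)
    (h : ∑ k, pureState (ξ k) = ∑ i, pureState (φ i)) :
    ∃ W : Matrix κ (κ ⊕ μ) ℂ, W * Wᴴ = 1 ∧ ∀ i, φ i = ∑ k, W k (Sum.inr i) • ξ k := by
  classical
  let e : (κ ⊕ μ → ℂ) ≃ₗ[ℂ] EuclideanSpace ℂ (κ ⊕ μ) := (WithLp.linearEquiv 2 ℂ (κ ⊕ μ → ℂ)).symm
  -- `T` and `T'` list the overlaps with the `ξ k` and the `φ i`, padded by zeros to land in one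
  -- space. Their norms agree, both being given by the quadratic form of the common operator, so `T
  -- x ↦ T' x` is an isometry on the range of `T` and extends to the whole space.
  let T : (ι → ℂ) →ₗ[ℂ] EuclideanSpace ℂ (κ ⊕ μ) := e.toLinearMap ∘ₗ
    LinearMap.pi (Sum.elim (fun k => dotProductBilin ℂ ℂ (star (ξ k))) fun _ => 0)
  let T' : (ι → ℂ) →ₗ[ℂ] EuclideanSpace ℂ (κ ⊕ μ) := e.toLinearMap ∘ₗ
    LinearMap.pi (Sum.elim (fun _ => 0) fun i => dotProductBilin ℂ ℂ (star (φ i)))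
  have hTl : ∀ x k, T x (Sum.inl k) = star (ξ k) ⬝ᵥ x := fun x k => rfl
  have hTr : ∀ x i, T x (Sum.inr i) = 0 := fun x k => rfl
  have hTl' : ∀ x k, T' x (Sum.inl k) = 0 := fun x k => rfl
  have hTr' : ∀ x i, T' x (Sum.inr i) = star (φ i) ⬝ᵥ x := fun x k => rfl
  have hnorm : ∀ x, ‖T' x‖ = ‖T x‖ := by
    intro x
    rw [EuclideanSpace.norm_eq, EuclideanSpace.norm_eq]
    congr 1
    simp only [Fintype.sum_sum_type, hTl, hTr, hTl', hTr']
    simp only [norm_zero, ne_eq, OfNat.ofNat_ne_zero, not_false_eq_true, zero_pow,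
      Finset.sum_const_zero, add_zero, zero_add]
    have := sum_norm_sq_dotProduct_of_sum_pureState φ x
    rw [← h, ← sum_norm_sq_dotProduct_of_sum_pureState ξ x] at this
    exact_mod_cast this
  obtain ⟨s, hs⟩ := T.rangeRestrict.exists_rightInverse_of_surjective T.range_rangeRestrict
  have hs' : ∀ v, T (s v) = v := fun v => congrArg Subtype.val (LinearMap.congr_fun hs v)
  let L₀ : LinearMap.range T →ₗᵢ[ℂ] EuclideanSpace ℂ (κ ⊕ μ) :=
    { toLinearMap := T' ∘ₗ s
      norm_map' := fun v => by
        simp only [LinearMap.comp_apply]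
        rw [hnorm, hs']
        rfl }
  let L := L₀.extend
  have hL : ∀ x, L (T x) = T' x := by
    intro x
    have h1 : L (T x) = L₀ (T.rangeRestrict x) := L₀.extend_apply (T.rangeRestrict x)
    have h2 : L₀ (T.rangeRestrict x) = T' (s (T.rangeRestrict x)) := rfl
    rw [h1, h2, ← sub_eq_zero, ← map_sub, ← norm_eq_zero, hnorm, map_sub, hs']
    simp
  let b : κ ⊕ μ → EuclideanSpace ℂ (κ ⊕ μ) := fun a => EuclideanSpace.single a 1
  -- The rows of `W` are the conjugated images of orthonormal basis vectors under `L`, hence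
  -- orthonormal.
  refine ⟨Matrix.of fun k a => star (L (b (Sum.inl k)) a), ?_, fun i => ?_⟩
  · ext k k'
    have h1 : (inner ℂ (L (b (Sum.inl k))) (L (b (Sum.inl k'))) : ℂ)
        = inner ℂ (b (Sum.inl k)) (b (Sum.inl k')) := L.inner_map_map _ _
    rw [PiLp.inner_apply] at h1
    simp only [mul_apply, of_apply, conjTranspose_apply, star_star, Matrix.one_apply]
    rw [show (inner ℂ (b (Sum.inl k)) (b (Sum.inl k')) : ℂ) = if k = k' then 1 else 0 by
      simp [b, EuclideanSpace.inner_single_left]] at h1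
    rw [← h1]
    exact Finset.sum_congr rfl fun a _ => mul_comm _ _
  · have key : ∀ x, star (φ i) ⬝ᵥ x
        = ∑ k, (star (ξ k) ⬝ᵥ x) * L (b (Sum.inl k)) (Sum.inr i) := by
      intro x
      rw [← hTr', ← hL]
      have hx : T x = ∑ k, (star (ξ k) ⬝ᵥ x) • b (Sum.inl k) := by
        ext a
        rcases a with a | a
        · simp [hTl, b, Pi.single_apply]
        · simp [hTr, b]
      rw [hx, map_sum]
      simp
    ext x
    have := congrArg star (key (Pi.single x 1))
    simpa [mul_comm] using this

omit [Fintype ι] in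
theorem sum_pureState_coisometry [DecidableEq κ] (ξ : κ → ι → ℂ) {W : Matrix κ μ ℂ}
    (hW : W * Wᴴ = 1) :
    ∑ i, pureState (∑ k, W k i • ξ k) = ∑ k, pureState (ξ k) := by
  ext x y
  have h : ∀ k k', ∑ i, W k i * star (W k' i) = if k = k' then 1 else 0 := fun k k' => by
    simpa [mul_apply, Matrix.one_apply] using congrFun (congrFun hW k) k'
  simp only [Matrix.sum_apply, pureState_apply, Finset.sum_apply, Pi.smul_apply, smul_eq_mul,
    star_sum, star_mul', Finset.sum_mul_sum]
  rw [Finset.sum_comm]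
  refine Finset.sum_congr rfl fun k _ => ?_
  rw [Finset.sum_comm]
  have : ∀ k', ∑ i, W k i * ξ k x * (star (W k' i) * star (ξ k' y))
      = (∑ i, W k i * star (W k' i)) * (ξ k x * star (ξ k' y)) := fun k' => by
    rw [Finset.sum_mul]
    exact Finset.sum_congr rfl fun _ _ => by ring
  simp only [this, h]
  simp [-Complex.star_def, -RCLike.star_def]

/-- A convex roof extends the function on pure states. -/
theorem ensembleAverages_pureState {f : (ι → ℂ) → ℝ} (hf : IsQuadraticallyHomogeneous f)
    {ψ : ι → ℂ} (hψ : IsUnitVector ψ) : ensembleAverages f (pureState ψ) = {f ψ} := by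
  have h1 := isUnitVector_iff.1 hψ
  ext x
  simp only [Set.mem_singleton_iff]
  constructor
  · intro hx
    obtain ⟨m, φ, h, rfl⟩ := exists_decomposition_of_mem_ensembleAverages hf hx
    -- With a single vector on one side, the coisometry makes every term of the decomposition a
    -- multiple of `ψ`.
    obtain ⟨W, -, hφ⟩ := exists_coisometry_of_sum_pureState_eq (fun _ : Unit => ψ) φ (by simpa)
    simp only [Finset.univ_unique, Finset.sum_singleton] at hφ
    simp only [hφ, hf _ _, ← Finset.sum_mul]
    rw [h, prob_sum] at h1
    simp only [hφ, pureState_smul, prob_smul, isUnitVector_iff.1 hψ, mul_one] at h1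
    rw [h1, one_mul]
  · rintro rfl
    simpa using sum_mem_ensembleAverages (κ := Unit) hf (fun _ => ψ) (by simp) h1

end steering

/-! ### Roots of Gram determinants -/

section gram

theorem Matrix.PosSemidef.det_eq_re {n : Type*} [Fintype n] [DecidableEq n] {P : Matrix n n ℂ}
    (h : P.PosSemidef) : P.det = (P.det.re : ℂ) := by
  have := h.det_nonneg
  rw [Complex.nonneg_iff] at this
  exact Complex.ext rfl (by simpa using this.2.symm)

theorem Matrix.PosSemidef.det_re_nonneg {n : Type*} [Fintype n] [DecidableEq n] {P : Matrix n n ℂ}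
    (h : P.PosSemidef) : 0 ≤ P.det.re :=
  (Complex.nonneg_iff.1 h.det_nonneg).1

open scoped MatrixOrder Matrix.Norms.L2Operator in
theorem Matrix.PosSemidef.exists_eq_conjTranspose_mul_self {n : Type*} [Fintype n] [DecidableEq n]
    {P : Matrix n n ℂ} (h : P.PosSemidef) : ∃ B : Matrix n n ℂ, P = Bᴴ * B :=
  CStarAlgebra.nonneg_iff_eq_star_mul_self.mp h.nonneg

/-- The arithmetic-geometric mean inequality for the eigenvalues of a positive matrix. -/
theorem Matrix.PosSemidef.mul_det_rpow_le_trace {d : ℕ} {P : Matrix (Fin d) (Fin d) ℂ}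
    (h : P.PosSemidef) : d * P.det.re ^ (1 / (d : ℝ)) ≤ P.trace.re := by
  rcases Nat.eq_zero_or_pos d with rfl | hd
  · simp [Matrix.trace]
  have hd' : (0 : ℝ) < d := by exact_mod_cast hd
  have hdet : P.det.re = ∏ i, h.1.eigenvalues i := by
    rw [h.1.det_eq_prod_eigenvalues]
    simp only [Complex.coe_algebraMap, ← Complex.ofReal_prod, Complex.ofReal_re]
  have htr : P.trace.re = ∑ i, h.1.eigenvalues i := by
    rw [h.1.trace_eq_sum_eigenvalues]
    simp
  have := Real.geom_mean_le_arith_mean Finset.univ (fun _ => 1) h.1.eigenvalues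
    (fun _ _ => zero_le_one) (by simpa using hd) fun i _ => h.eigenvalues_nonneg i
  simp only [Real.rpow_one, one_mul, Finset.sum_const, Finset.card_univ, Fintype.card_fin,
    nsmul_eq_mul, mul_one] at this
  rw [hdet, htr, one_div]
  rwa [le_div_iff₀ hd', mul_comm] at this

variable {m : Type*} [Fintype m] {d : ℕ}

/-- The `d`-th root of the Gram determinant of the `d` columns of `A`. -/
def gramRoot (A : Matrix m (Fin d) ℂ) : ℝ := (Aᴴ * A).det.re ^ (1 / (d : ℝ))

theorem gramRoot_nonneg (A : Matrix m (Fin d) ℂ) : 0 ≤ gramRoot A :=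
  Real.rpow_nonneg (posSemidef_conjTranspose_mul_self A).det_re_nonneg _

theorem gramRoot_one : gramRoot (1 : Matrix (Fin d) (Fin d) ℂ) = 1 := by
  simp [gramRoot]

theorem mul_gramRoot_le (A : Matrix m (Fin d) ℂ) : d * gramRoot A ≤ (Aᴴ * A).trace.re :=
  (posSemidef_conjTranspose_mul_self A).mul_det_rpow_le_trace

theorem gramRoot_mul (A : Matrix m (Fin d) ℂ) (B : Matrix (Fin d) (Fin d) ℂ) :
    gramRoot (A * B) = gramRoot A * gramRoot B := by
  have hA := posSemidef_conjTranspose_mul_self A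
  have hB := posSemidef_conjTranspose_mul_self B
  have h : ((A * B)ᴴ * (A * B)).det = (Aᴴ * A).det * (Bᴴ * B).det := by
    rw [conjTranspose_mul, Matrix.mul_assoc, ← Matrix.mul_assoc Aᴴ, det_mul, det_mul, det_mul]
    ring
  rw [gramRoot, gramRoot, gramRoot, ← Real.mul_rpow hA.det_re_nonneg hB.det_re_nonneg, h,
    hA.det_eq_re, hB.det_eq_re, ← Complex.ofReal_mul]
  simp only [Complex.ofReal_re]

theorem gramRoot_transpose (B : Matrix (Fin d) (Fin d) ℂ) : gramRoot Bᵀ = gramRoot B := by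
  rw [gramRoot, gramRoot, det_mul, det_mul, det_conjTranspose, det_conjTranspose, det_transpose]

theorem gramRoot_smul (hd : d ≠ 0) (c : ℂ) (A : Matrix m (Fin d) ℂ) :
    gramRoot (c • A) = ‖c‖ ^ 2 * gramRoot A := by
  have hA := posSemidef_conjTranspose_mul_self A
  have h : ((c • A)ᴴ * (c • A)).det = (((‖c‖ ^ 2) ^ d : ℝ) : ℂ) * (Aᴴ * A).det := by
    rw [conjTranspose_smul, Matrix.smul_mul, Matrix.mul_smul, smul_smul, det_smul,
      Fintype.card_fin, Complex.star_def, Complex.conj_mul']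
    push_cast
    rfl
  rw [gramRoot, gramRoot, h, Complex.re_ofReal_mul, Real.mul_rpow (by positivity) hA.det_re_nonneg,
    one_div, Real.pow_rpow_inv_natCast (by positivity) hd]

theorem continuous_gramRoot (hd : d ≠ 0) : Continuous (gramRoot : Matrix m (Fin d) ℂ → ℝ) := by
  unfold gramRoot
  refine Continuous.rpow_const ?_ fun _ => Or.inr (by positivity)
  have : Continuous fun A : Matrix m (Fin d) ℂ => (Aᴴ * A).det :=
    (continuous_id.matrix_conjTranspose.matrix_mul continuous_id).matrix_det
  exact Complex.continuous_re.comp this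

theorem gramRoot_mul_eq_zero_of_gramRoot_eq_zero {l : Type*} [Fintype l] {A : Matrix m (Fin d) ℂ}
    (h : gramRoot A = 0) (X : Matrix l m ℂ) : gramRoot (X * A) = 0 := by
  have hA := posSemidef_conjTranspose_mul_self A
  obtain ⟨h0, h1⟩ := (Real.rpow_eq_zero_iff_of_nonneg hA.det_re_nonneg).1 h
  have hdet : (Aᴴ * A).det = 0 := by rw [hA.det_eq_re, h0, Complex.ofReal_zero]
  obtain ⟨v, hv, hv0⟩ := exists_mulVec_eq_zero_iff.2 hdet
  have hAv := (conjTranspose_mul_self_mulVec_eq_zero A v).1 hv0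
  have : ((X * A)ᴴ * (X * A)).det = 0 := by
    refine exists_mulVec_eq_zero_iff.1 ⟨v, hv, ?_⟩
    rw [← mulVec_mulVec, ← mulVec_mulVec, hAv, mulVec_zero, mulVec_zero]
  rw [gramRoot, this, Complex.zero_re, Real.zero_rpow h1]

/-- A superadditivity of the Minkowski determinant inequality type. -/
theorem sum_gramRoot_mul_le [DecidableEq m] (hd : d ≠ 0) {κ : Type*} [Fintype κ] {l : κ → Type*}
    [∀ k, Fintype (l k)] (X : ∀ k, Matrix (l k) m ℂ)
    (hX : (1 - ∑ k, (X k)ᴴ * X k).PosSemidef) (A : Matrix m (Fin d) ℂ) :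
    ∑ k, gramRoot (X k * A) ≤ gramRoot A := by
  by_cases h : gramRoot A = 0
  · simp [gramRoot_mul_eq_zero_of_gramRoot_eq_zero h, h]
  obtain ⟨B, hB⟩ := (posSemidef_conjTranspose_mul_self A).exists_eq_conjTranspose_mul_self
  have hAB : gramRoot A = gramRoot B := by rw [gramRoot, gramRoot, hB]
  have hBu : IsUnit B.det := by
    rw [isUnit_iff_ne_zero]
    intro h0
    refine h ?_
    rw [hAB, gramRoot, det_mul, h0, mul_zero, Complex.zero_re, Real.zero_rpow (by positivity)]
  -- `Q` has orthonormal columns, so the trace bound on the `X k * Q` totals at most `d`;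
  -- multiplicativity then restores the factor `B`.
  set Q := A * B⁻¹ with hQ
  have hQB : Q * B = A := by rw [hQ, Matrix.mul_assoc, nonsing_inv_mul _ hBu, Matrix.mul_one]
  have hQQ : Qᴴ * Q = 1 := by
    rw [hQ, conjTranspose_mul, Matrix.mul_assoc, ← Matrix.mul_assoc Aᴴ, hB, Matrix.mul_assoc,
      mul_nonsing_inv _ hBu, Matrix.mul_one, ← conjTranspose_mul, mul_nonsing_inv _ hBu,
      conjTranspose_one]
  have htr : ∑ k, ((X k * Q)ᴴ * (X k * Q)).trace.re ≤ d := by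
    have h1 := (hX.conjTranspose_mul_mul_same Q).trace_nonneg
    have h2 : Qᴴ * (1 - ∑ k, (X k)ᴴ * X k) * Q = 1 - ∑ k, (X k * Q)ᴴ * (X k * Q) := by
      simp only [Matrix.mul_sub, Matrix.sub_mul, Matrix.mul_one, hQQ, Matrix.mul_sum,
        Matrix.sum_mul, conjTranspose_mul, Matrix.mul_assoc]
    rw [h2, trace_sub, trace_one, trace_sum] at h1
    have h3 := (Complex.nonneg_iff.1 h1).1
    simp only [Fintype.card_fin, Complex.sub_re, Complex.natCast_re, Complex.re_sum] at h3
    linarith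
  have hd' : (0 : ℝ) < d := by positivity
  have hsum : ∑ k, gramRoot (X k * Q) ≤ 1 := by
    have : d * ∑ k, gramRoot (X k * Q) ≤ d := by
      rw [Finset.mul_sum]
      exact (Finset.sum_le_sum fun k _ => mul_gramRoot_le (X k * Q)).trans htr
    nlinarith
  calc ∑ k, gramRoot (X k * A) = (∑ k, gramRoot (X k * Q)) * gramRoot B := by
        rw [Finset.sum_mul]
        exact Finset.sum_congr rfl fun k _ => by rw [← gramRoot_mul, Matrix.mul_assoc, hQB]
    _ ≤ 1 * gramRoot B := mul_le_mul_of_nonneg_right hsum (gramRoot_nonneg B)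
    _ = gramRoot A := by rw [one_mul, hAB]

end gram

/-! ### Unnormalized decompositions and concave roofs -/

section decompositionSums

variable {ι κ : Type} [Fintype ι] [Fintype κ]

/-- The sums `∑ f(φᵢ)` over all finite decompositions `ρ = ∑ |φᵢ⟩⟨φᵢ|` into unnormalized
vectors. -/
def decompositionSums (f : (ι → ℂ) → ℝ) (ρ : Matrix ι ι ℂ) : Set ℝ :=
  {x | ∃ (m : ℕ) (φ : Fin m → ι → ℂ), ρ = ∑ k, pureState (φ k) ∧ x = ∑ k, f (φ k)}

omit [Fintype ι] in
theorem sum_mem_decompositionSums (f : (ι → ℂ) → ℝ) {ρ : Matrix ι ι ℂ} (φ : κ → ι → ℂ)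
    (hρ : ρ = ∑ k, pureState (φ k)) : ∑ k, f (φ k) ∈ decompositionSums f ρ := by
  let e := (Fintype.equivFin κ).symm
  refine ⟨_, φ ∘ e, ?_, ?_⟩
  · rw [hρ]; exact (e.sum_comp fun k => pureState (φ k)).symm
  · exact (e.sum_comp fun k => f (φ k)).symm

theorem ensembleAverages_eq_decompositionSums {f : (ι → ℂ) → ℝ}
    (hf : IsQuadraticallyHomogeneous f) {ρ : Matrix ι ι ℂ} (h1 : prob ρ = 1) :
    ensembleAverages f ρ = decompositionSums f ρ := by
  ext x
  constructor
  · exact exists_decomposition_of_mem_ensembleAverages hf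
  · rintro ⟨m, φ, h, rfl⟩
    exact sum_mem_ensembleAverages hf φ h h1

omit [Fintype ι] in
theorem IsQuadraticallyHomogeneous.neg {f : (ι → ℂ) → ℝ} (hf : IsQuadraticallyHomogeneous f) :
    IsQuadraticallyHomogeneous (-f) := fun c φ => by
  simp only [Pi.neg_apply, hf c φ]; ring

theorem neg_mem_ensembleAverages_neg {f : (ι → ℂ) → ℝ} {ρ : Matrix ι ι ℂ} {x : ℝ} :
    -x ∈ ensembleAverages (-f) ρ ↔ x ∈ ensembleAverages f ρ := by
  refine exists_congr fun m => exists_congr fun p => exists_congr fun φ => ?_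
  refine and_congr_right fun _ => and_congr_right fun _ => and_congr_right fun _ =>
    and_congr_right fun _ => ?_
  simp only [Pi.neg_apply, mul_neg, Finset.sum_neg_distrib, neg_inj]

/-- The concave roof of a continuous function is attained. -/
theorem exists_isGreatest_ensembleAverages {f : (ι → ℂ) → ℝ} (hf : IsQuadraticallyHomogeneous f)
    (hc : Continuous f) {C : ℝ} (hC : ∀ φ, IsUnitVector φ → |f φ| ≤ C)
    {ρ : Matrix ι ι ℂ} (hρ : IsState ρ) : ∃ x, IsGreatest (ensembleAverages f ρ) x := by
  have h := isLeast_sInf_ensembleAverages hf.neg hc.neg.lowerSemicontinuous (C := C)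
    (fun φ hφ => by simpa using hC φ hφ) hρ
  refine ⟨-sInf (ensembleAverages (-f) ρ), ?_, fun y hy => ?_⟩
  · rw [← neg_mem_ensembleAverages_neg, neg_neg]; exact h.1
  · have := h.2 (neg_mem_ensembleAverages_neg.2 hy)
    linarith

theorem exists_isGreatest_decompositionSums {f : (ι → ℂ) → ℝ} (hf : IsQuadraticallyHomogeneous f)
    (hc : Continuous f) (h0 : ∀ φ, 0 ≤ f φ) (hle : ∀ φ, f φ ≤ prob (pureState φ))
    {ρ : Matrix ι ι ℂ} (hρ : ρ.PosSemidef) : ∃ x, IsGreatest (decompositionSums f ρ) x := by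
  have hnn : 0 ≤ prob ρ := (Complex.nonneg_iff.1 hρ.trace_nonneg).1
  rcases hnn.eq_or_lt with h | h
  -- With trace 0 there is nothing to normalize, but `0 ≤ f ≤ prob` forces every sum to vanish.
  · have key : ∀ x ∈ decompositionSums f ρ, x = 0 := by
      rintro x ⟨m, φ, rfl, rfl⟩
      refine le_antisymm ?_ (Finset.sum_nonneg fun k _ => h0 _)
      rw [h, prob_sum]
      exact Finset.sum_le_sum fun k _ => hle _
    obtain ⟨m, φ, hφ⟩ := hρ.exists_eq_sum_pureState
    have := sum_mem_decompositionSums f φ hφ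
    rw [key _ this] at this
    exact ⟨0, this, fun x hx => (key x hx).le⟩
  · have hst : IsState (normalized ρ) := isState_iff.2
      ⟨hρ.smul (inv_nonneg.2 hnn), by rw [normalized, prob_smul, inv_mul_cancel₀ h.ne']⟩
    obtain ⟨t, ht, hmax⟩ := exists_isGreatest_ensembleAverages hf hc (C := 1)
      (fun φ hφ => by rw [abs_of_nonneg (h0 φ)]; exact (hle φ).trans (isUnitVector_iff.1 hφ).le) hst
    obtain ⟨m, φ, hφ, rfl⟩ := exists_decomposition_of_mem_ensembleAverages hf ht
    have key : ‖((√(prob ρ) : ℝ) : ℂ)‖ ^ 2 = prob ρ := by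
      rw [Complex.norm_real, Real.norm_eq_abs, sq_abs, Real.sq_sqrt hnn]
    refine ⟨_, sum_mem_decompositionSums f (fun k => ((√(prob ρ) : ℝ) : ℂ) • φ k) ?_, ?_⟩
    · simp only [pureState_smul, key, ← Finset.smul_sum, ← hφ, normalized]
      rw [smul_smul, mul_inv_cancel₀ h.ne', one_smul]
    · rintro x ⟨m', φ', hφ', rfl⟩
      simp only [hf _ _, key, ← Finset.mul_sum]
      rw [← inv_mul_le_iff₀ h]
      exact hmax (average_mem_ensembleAverages hf φ' hφ' h)

theorem prob_mul_sInf_ensembleAverages_pureState {f : (ι → ℂ) → ℝ}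
    (hf : IsQuadraticallyHomogeneous f) (φ : ι → ℂ) :
    prob (pureState φ) * sInf (ensembleAverages f (normalized (pureState φ))) = f φ := by
  by_cases h : φ = 0
  · rw [h, hf.map_zero, pureState_zero]; simp [prob]
  have hpos : 0 < prob (pureState φ) := (prob_pureState_nonneg φ).lt_of_ne'
    fun h' => h (prob_pureState_eq_zero.1 h')
  have key : ‖(((√(prob (pureState φ)))⁻¹ : ℝ) : ℂ)‖ ^ 2 = (prob (pureState φ))⁻¹ := by
    rw [Complex.norm_real, Real.norm_eq_abs, sq_abs, inv_pow, Real.sq_sqrt hpos.le]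
  have h1 : normalized (pureState φ)
      = pureState ((((√(prob (pureState φ)))⁻¹ : ℝ) : ℂ) • φ) := by
    rw [pureState_smul, key, normalized]
  have h2 : IsUnitVector ((((√(prob (pureState φ)))⁻¹ : ℝ) : ℂ) • φ) := by
    rw [isUnitVector_iff, ← h1, normalized, prob_smul, inv_mul_cancel₀ hpos.ne']
  rw [h1, ensembleAverages_pureState hf h2, csInf_singleton, hf, key, mul_inv_cancel_left₀ hpos.ne']

end decompositionSums

/-! ### G-concurrence of bipartite vectors -/

section gConcurrence

variable {d : ℕ}

theorem gConcurrencePure_eq (φ : Fin d × Fin d → ℂ) :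
    gConcurrencePure φ = d * gramRoot (Matrix.of fun i j => φ (i, j)) := rfl

theorem gConcurrencePure_nonneg (φ : Fin d × Fin d → ℂ) : 0 ≤ gConcurrencePure φ := by
  rw [gConcurrencePure_eq]
  exact mul_nonneg (Nat.cast_nonneg d) (gramRoot_nonneg _)

theorem gConcurrencePure_le_prob (φ : Fin d × Fin d → ℂ) :
    gConcurrencePure φ ≤ prob (pureState φ) := by
  rw [gConcurrencePure_eq]
  refine (mul_gramRoot_le _).trans_eq ?_
  rw [prob_pureState, Fintype.sum_prod_type_right]
  simp only [trace, diag_apply, mul_apply, conjTranspose_apply, of_apply, Complex.re_sum]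
  refine Finset.sum_congr rfl fun i _ => Finset.sum_congr rfl fun j _ => ?_
  rw [Complex.star_def, Complex.conj_mul']
  norm_cast

theorem gConcurrencePure_homogeneous (hd : d ≠ 0) :
    IsQuadraticallyHomogeneous (gConcurrencePure (d := d)) := by
  intro c φ
  rw [gConcurrencePure_eq, gConcurrencePure_eq,
    show (Matrix.of fun i j => (c • φ) (i, j)) = c • Matrix.of fun i j => φ (i, j) from rfl,
    gramRoot_smul hd]
  ring

theorem continuous_gConcurrencePure (hd : d ≠ 0) :
    Continuous (gConcurrencePure (d := d)) := by
  refine continuous_const.mul ((continuous_gramRoot hd).comp ?_)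
  exact continuous_matrix fun i j => continuous_apply (i, j)

/-- On coefficient matrices A ⊗ B acts as Φ ↦ A Φ Bᵀ, and `gramRoot` is multiplicative on square
matrices. -/
theorem gConcurrencePure_kronecker_mulVec (A B : Matrix (Fin d) (Fin d) ℂ)
    (φ : Fin d × Fin d → ℂ) :
    gConcurrencePure ((A ⊗ₖ B) *ᵥ φ) = gramRoot A * gramRoot B * gConcurrencePure φ := by
  have h : (Matrix.of fun i j => ((A ⊗ₖ B) *ᵥ φ) (i, j))
      = A * (Matrix.of fun i j => φ (i, j)) * Bᵀ := by
    ext i j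
    simp only [of_apply, mulVec, dotProduct, Fintype.sum_prod_type_right, kroneckerMap_apply,
      mul_apply, transpose_apply, Finset.sum_mul]
    exact Finset.sum_congr rfl fun _ _ => Finset.sum_congr rfl fun _ _ => by ring
  rw [gConcurrencePure_eq, gConcurrencePure_eq, h, gramRoot_mul, gramRoot_mul, gramRoot_transpose]
  ring

end gConcurrence

/-! ### Slices along Sapna's basis -/

section slices

variable {a b n : ℕ}

/-- The vector of Alice and Bob that belongs to the basis vector `k` of Sapna. -/
def slice (ψ : Fin a × Fin b × Fin n → ℂ) (k : Fin n) : Fin a × Fin b → ℂ :=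
  fun x => ψ (x.1, x.2, k)

theorem reducedAB_pureState (ψ : Fin a × Fin b × Fin n → ℂ) :
    reducedAB (pureState ψ) = ∑ k, pureState (slice ψ k) := by
  ext x y
  simp only [reducedAB, of_apply, Matrix.sum_apply]
  rfl

theorem reducedAB_sum {κ : Type*} [Fintype κ] (ρ : κ → TripartiteOp a b n) :
    reducedAB (∑ l, ρ l) = ∑ l, reducedAB (ρ l) := by
  ext x y
  simp only [reducedAB, of_apply, Matrix.sum_apply]
  exact Finset.sum_comm

theorem prob_reducedAB_pureState (ψ : Fin a × Fin b × Fin n → ℂ) :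
    prob (reducedAB (pureState ψ)) = prob (pureState ψ) := by
  rw [reducedAB_pureState, prob_sum]
  simp only [prob_pureState, slice, Fintype.sum_prod_type]
  rw [Finset.sum_comm]
  exact Finset.sum_congr rfl fun i _ => Finset.sum_comm

theorem slice_smul (c : ℂ) (ψ : Fin a × Fin b × Fin n → ℂ) (k : Fin n) :
    slice (c • ψ) k = c • slice ψ k := rfl

theorem slice_local_mulVec {a' b' : ℕ} (A : Matrix (Fin a') (Fin a) ℂ)
    (B : Matrix (Fin b') (Fin b) ℂ) (ψ : Fin a × Fin b × Fin n → ℂ) (k : Fin n) :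
    slice ((A ⊗ₖ (B ⊗ₖ (1 : Matrix (Fin n) (Fin n) ℂ))) *ᵥ ψ) k = (A ⊗ₖ B) *ᵥ slice ψ k := by
  ext x
  simp only [slice, mulVec, dotProduct, Fintype.sum_prod_type, kroneckerMap_apply,
    Matrix.one_apply]
  simp

theorem slice_sapna_mulVec {n' : ℕ} (M : Matrix (Fin n') (Fin n) ℂ)
    (ψ : Fin a × Fin b × Fin n → ℂ) (r : Fin n') :
    slice (((1 : Matrix (Fin a) (Fin a) ℂ) ⊗ₖ ((1 : Matrix (Fin b) (Fin b) ℂ) ⊗ₖ M)) *ᵥ ψ) r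
      = ∑ c, M r c • slice ψ c := by
  ext x
  simp only [slice, mulVec, dotProduct, Fintype.sum_prod_type, kroneckerMap_apply,
    Matrix.one_apply, Finset.sum_apply, Pi.smul_apply, smul_eq_mul]
  simp

/-- The sum depends on `M` only through `Mᴴ * M`; hence completing a measurement requires only a
square root of the missing part. -/
theorem sum_pureState_mul {ι κ μ : Type} [Fintype κ] [Fintype μ] (M : Matrix μ κ ℂ)
    (ξ : κ → ι → ℂ) :
    ∑ r, pureState (∑ c, M r c • ξ c)
      = ∑ c, ∑ c', (Mᴴ * M) c' c • vecMulVec (ξ c) (star (ξ c')) := by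
  ext x y
  simp only [Matrix.sum_apply, pureState_apply, Finset.sum_apply, Pi.smul_apply, smul_eq_mul,
    star_sum, star_mul', Finset.mul_sum, Matrix.smul_apply, mul_apply, conjTranspose_apply,
    vecMulVec_apply, Pi.star_apply, Finset.sum_mul]
  rw [Finset.sum_comm]
  conv_rhs => rw [Finset.sum_comm]
  refine Finset.sum_congr rfl fun c _ => ?_
  rw [Finset.sum_comm]
  exact Finset.sum_congr rfl fun c' _ => Finset.sum_congr rfl fun r _ => by ring

/-- An incomplete measurement of Sapna can be completed without disturbing the reduced state of
Alice and Bob. -/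
theorem exists_complement_sum_pureState {ι κ τ : Type} [Fintype κ] [DecidableEq κ] [Fintype τ]
    {μ : τ → Type} [∀ t, Fintype (μ t)] (M : ∀ t, Matrix (μ t) κ ℂ)
    (hM : (1 - ∑ t, (M t)ᴴ * M t).PosSemidef) (ξ : κ → ι → ℂ) :
    ∃ χ : κ → ι → ℂ, ∑ t, ∑ r, pureState (∑ c, M t r c • ξ c) + ∑ r, pureState (χ r)
      = ∑ c, pureState (ξ c) := by
  obtain ⟨N, hN⟩ := hM.exists_eq_conjTranspose_mul_self
  refine ⟨fun r => ∑ c, N r c • ξ c, ?_⟩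
  have h1 := sum_pureState_mul (1 : Matrix κ κ ℂ) ξ
  have h2 : (1 : Matrix κ κ ℂ)ᴴ * 1 = ∑ t, (M t)ᴴ * M t + Nᴴ * N := by
    rw [← hN]; simp
  have h3 : ∑ r, pureState (∑ c, (1 : Matrix κ κ ℂ) r c • ξ c) = ∑ c, pureState (ξ c) := by
    simp [Matrix.one_apply]
  rw [← h3, h1, h2]
  simp only [sum_pureState_mul, Matrix.add_apply, Matrix.sum_apply, add_smul,
    Finset.sum_add_distrib, Finset.sum_smul]
  congr 1
  rw [Finset.sum_comm]
  exact Finset.sum_congr rfl fun c _ => Finset.sum_comm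

end slices

/-! ### Assistance of vectors and its convex roof -/

section assistance

variable {d n : ℕ}

/-- The G-concurrence of assistance of an unnormalized vector. -/
def assistance (ψ : Fin d × Fin d × Fin n → ℂ) : ℝ :=
  sSup (decompositionSums gConcurrencePure (reducedAB (pureState ψ)))

theorem isGreatest_assistance (hd : d ≠ 0) (ψ : Fin d × Fin d × Fin n → ℂ) :
    IsGreatest (decompositionSums gConcurrencePure (reducedAB (pureState ψ))) (assistance ψ) := by
  have hpsd : (reducedAB (pureState ψ)).PosSemidef := by
    rw [reducedAB_pureState]; exact posSemidef_sum_pureState _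
  obtain ⟨x, hx⟩ := exists_isGreatest_decompositionSums (gConcurrencePure_homogeneous hd)
    (continuous_gConcurrencePure hd) gConcurrencePure_nonneg gConcurrencePure_le_prob hpsd
  rwa [assistance, hx.csSup_eq]

theorem le_assistance (hd : d ≠ 0) {κ : Type} [Fintype κ] {ψ : Fin d × Fin d × Fin n → ℂ}
    (φ : κ → Fin d × Fin d → ℂ) (h : ∑ k, pureState (slice ψ k) = ∑ k, pureState (φ k)) :
    ∑ k, gConcurrencePure (φ k) ≤ assistance ψ :=
  (isGreatest_assistance hd ψ).2
    (sum_mem_decompositionSums _ φ (by rw [reducedAB_pureState, h]))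

theorem exists_assistance_eq (hd : d ≠ 0) (ψ : Fin d × Fin d × Fin n → ℂ) :
    ∃ (m : ℕ) (φ : Fin m → Fin d × Fin d → ℂ),
      ∑ k, pureState (slice ψ k) = ∑ k, pureState (φ k) ∧
      assistance ψ = ∑ k, gConcurrencePure (φ k) := by
  obtain ⟨m, φ, h, h'⟩ := (isGreatest_assistance hd ψ).1
  exact ⟨m, φ, by rw [← reducedAB_pureState, h], h'⟩

theorem assistance_le_prob (hd : d ≠ 0) (ψ : Fin d × Fin d × Fin n → ℂ) :
    assistance ψ ≤ prob (pureState ψ) := by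
  obtain ⟨m, φ, h, h'⟩ := exists_assistance_eq hd ψ
  rw [h', ← prob_reducedAB_pureState, reducedAB_pureState, h, prob_sum]
  exact Finset.sum_le_sum fun k _ => gConcurrencePure_le_prob _

theorem assistance_nonneg (ψ : Fin d × Fin d × Fin n → ℂ) : 0 ≤ assistance ψ := by
  refine Real.sSup_nonneg ?_
  rintro x ⟨m, φ, -, rfl⟩
  exact Finset.sum_nonneg fun k _ => gConcurrencePure_nonneg _

theorem assistance_homogeneous (hd : d ≠ 0) :
    IsQuadraticallyHomogeneous (assistance (d := d) (n := n)) := by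
  have key : ∀ (c : ℂ) (ψ : Fin d × Fin d × Fin n → ℂ),
      ‖c‖ ^ 2 * assistance ψ ≤ assistance (c • ψ) := by
    intro c ψ
    obtain ⟨m, φ, h, h'⟩ := exists_assistance_eq hd ψ
    rw [h', Finset.mul_sum]
    simp only [← gConcurrencePure_homogeneous hd c _]
    refine le_assistance hd _ ?_
    simp only [slice_smul, pureState_smul, ← Finset.smul_sum, h]
  intro c ψ
  refine le_antisymm ?_ (key c ψ)
  by_cases hc : c = 0
  · subst hc
    refine (assistance_le_prob hd _).trans_eq ?_
    simp [pureState_zero, prob]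
  -- The reverse inequality is the proved one for the inverse scalar.
  · have := key c⁻¹ (c • ψ)
    rw [smul_smul, inv_mul_cancel₀ hc, one_smul, norm_inv, inv_pow,
      inv_mul_le_iff₀ (by positivity)] at this
    exact this

theorem ensembleAverages_reducedAB (hd : d ≠ 0) {ψ : Fin d × Fin d × Fin n → ℂ}
    (hψ : IsUnitVector ψ) : ensembleAverages gConcurrencePure (reducedAB (pureState ψ))
      = decompositionSums gConcurrencePure (reducedAB (pureState ψ)) :=
  ensembleAverages_eq_decompositionSums (gConcurrencePure_homogeneous hd)
    (by rw [prob_reducedAB_pureState, isUnitVector_iff.1 hψ])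

theorem gAssistancePure_eq (hd : d ≠ 0) {ψ : Fin d × Fin d × Fin n → ℂ}
    (hψ : IsUnitVector ψ) : gAssistancePure ψ = assistance ψ := by
  rw [gAssistancePure, ensembleAverages_reducedAB hd hψ, assistance]

theorem ensembleAverages_gAssistancePure (hd : d ≠ 0) (ρ : TripartiteOp d d n) :
    ensembleAverages gAssistancePure ρ = ensembleAverages assistance ρ :=
  ensembleAverages_congr (fun _ => gAssistancePure_eq hd) ρ

theorem gAssistance_eq (hd : d ≠ 0) (ρ : TripartiteOp d d n) :
    gAssistance ρ = sInf (ensembleAverages assistance ρ) := by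
  rw [gAssistance, ensembleAverages_gAssistancePure hd]

/-- A coisometry `W` that is optimal at `ψ` turns the slices of every `χ` into a decomposition. Its
value `F χ` is continuous in `χ`, lies below the assistance, and reaches it at `ψ`. -/
theorem lowerSemicontinuous_assistance (hd : d ≠ 0) :
    LowerSemicontinuous (assistance (d := d) (n := n)) := by
  intro ψ y hy
  obtain ⟨m, φ, h, h'⟩ := exists_assistance_eq hd ψ
  obtain ⟨W, hW, hφ⟩ := exists_coisometry_of_sum_pureState_eq _ _ h
  let F : (Fin d × Fin d × Fin n → ℂ) → ℝ :=
    fun χ => ∑ i, gConcurrencePure (∑ k, W k i • slice χ k)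
  have hF : Continuous F := by
    refine continuous_finsetSum _ fun i _ => (continuous_gConcurrencePure hd).comp ?_
    exact continuous_finsetSum _ fun k _ =>
      continuous_pi fun x => continuous_const.mul (continuous_apply _)
  have hle : ∀ χ, F χ ≤ assistance χ := fun χ =>
    le_assistance hd _ (sum_pureState_coisometry (slice χ) hW).symm
  have hlt : y < F ψ := by
    refine hy.trans_le ?_
    rw [h']
    simp only [F, Fintype.sum_sum_type, ← hφ]
    exact le_add_of_nonneg_left (Finset.sum_nonneg fun _ _ => gConcurrencePure_nonneg _)
  filter_upwards [hF.continuousAt.eventually (lt_mem_nhds hlt)] with χ hχ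
  exact hχ.trans_le (hle χ)

theorem isLeast_gAssistance (hd : d ≠ 0) {ρ : TripartiteOp d d n} (hρ : IsState ρ) :
    IsLeast (ensembleAverages assistance ρ) (gAssistance ρ) := by
  rw [gAssistance_eq hd]
  refine isLeast_sInf_ensembleAverages (assistance_homogeneous hd)
    (lowerSemicontinuous_assistance hd) (C := 1) (fun φ hφ => ?_) hρ
  rw [abs_of_nonneg (assistance_nonneg φ)]
  exact (assistance_le_prob hd φ).trans (isUnitVector_iff.1 hφ).le

theorem exists_gAssistance_eq (hd : d ≠ 0) {ρ : TripartiteOp d d n} (hρ : IsState ρ) :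
    ∃ (m : ℕ) (ψ : Fin m → Fin d × Fin d × Fin n → ℂ),
      ρ = ∑ l, pureState (ψ l) ∧ gAssistance ρ = ∑ l, assistance (ψ l) :=
  exists_decomposition_of_mem_ensembleAverages (assistance_homogeneous hd)
    (isLeast_gAssistance hd hρ).1

theorem prob_mul_gAssistance_le (hd : d ≠ 0) {κ : Type} [Fintype κ] {ρ : TripartiteOp d d n}
    (ψ : κ → Fin d × Fin d × Fin n → ℂ) (hρ : ρ = ∑ l, pureState (ψ l)) :
    prob ρ * gAssistance (normalized ρ) ≤ ∑ l, assistance (ψ l) := by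
  rw [gAssistance_eq hd]
  exact prob_mul_sInf_ensembleAverages_le (assistance_homogeneous hd) assistance_nonneg ψ hρ

theorem convexOn_gAssistance (hd : d ≠ 0) :
    ConvexOn ℝ {ρ : TripartiteOp d d n | IsState ρ} gAssistance := by
  have hconv : Convex ℝ {ρ : TripartiteOp d d n | IsState ρ} := by
    intro ρ hρ σ hσ s t hs ht hst
    obtain ⟨hρ, hρ1⟩ := isState_iff.1 hρ
    obtain ⟨hσ, hσ1⟩ := isState_iff.1 hσ
    refine isState_iff.2 ⟨(hρ.smul hs).add (hσ.smul ht), ?_⟩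
    rw [prob_add, prob_smul, prob_smul, hρ1, hσ1, mul_one, mul_one, hst]
  refine ⟨hconv, fun ρ hρ σ hσ s t hs ht hst => ?_⟩
  obtain ⟨m, ψ, hψ, hψ'⟩ := exists_gAssistance_eq hd hρ
  obtain ⟨m', χ, hχ, hχ'⟩ := exists_gAssistance_eq hd hσ
  have h1 := (isState_iff.1 (hconv hρ hσ hs ht hst)).2
  have key : ∀ r : ℝ, 0 ≤ r → ‖((√r : ℝ) : ℂ)‖ ^ 2 = r := fun r hr => by
    rw [Complex.norm_real, Real.norm_eq_abs, sq_abs, Real.sq_sqrt hr]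
  have := prob_mul_gAssistance_le hd (ρ := s • ρ + t • σ)
    (Sum.elim (fun l => ((√s : ℝ) : ℂ) • ψ l) fun l => ((√t : ℝ) : ℂ) • χ l) (by
      simp only [Fintype.sum_sum_type, Sum.elim_inl, Sum.elim_inr, pureState_smul, key s hs,
        key t ht, ← Finset.smul_sum, ← hψ, ← hχ])
  rw [normalized_of_prob_eq_one h1, h1, one_mul] at this
  simpa only [Fintype.sum_sum_type, Sum.elim_inl, Sum.elim_inr, assistance_homogeneous hd _ _,
    key s hs, key t ht, ← Finset.mul_sum, ← hψ', ← hχ', smul_eq_mul] using this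

end assistance

/-! ### Local operators acting on the assistance -/

section localOperations

variable {d n : ℕ}

/-- The coisometry relating an optimal decomposition of the image to its slices also acts on the
slices of `ψ`. This pulls the decomposition back without inverting A ⊗ B, which may be singular. -/
theorem assistance_local_mulVec_le (hd : d ≠ 0) (A B : Matrix (Fin d) (Fin d) ℂ)
    (ψ : Fin d × Fin d × Fin n → ℂ) :
    assistance ((A ⊗ₖ (B ⊗ₖ (1 : Matrix (Fin n) (Fin n) ℂ))) *ᵥ ψ)
      ≤ gramRoot A * gramRoot B * assistance ψ := by
  obtain ⟨m, φ, h, h'⟩ := exists_assistance_eq hd ((A ⊗ₖ (B ⊗ₖ (1 : Matrix (Fin n) (Fin n) ℂ))) *ᵥ ψ)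
  obtain ⟨W, hW, hφ⟩ := exists_coisometry_of_sum_pureState_eq _ _ h
  have hφ' : ∀ i, φ i = (A ⊗ₖ B) *ᵥ ∑ k, W k (Sum.inr i) • slice ψ k := fun i => by
    rw [hφ, mulVec_sum]
    simp only [slice_local_mulVec, mulVec_smul]
  rw [h']
  simp only [hφ', gConcurrencePure_kronecker_mulVec, ← Finset.mul_sum]
  refine mul_le_mul_of_nonneg_left ?_ (mul_nonneg (gramRoot_nonneg A) (gramRoot_nonneg B))
  refine le_trans ?_ (le_assistance hd _ (sum_pureState_coisometry (slice ψ) hW).symm)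
  rw [Fintype.sum_sum_type]
  exact le_add_of_nonneg_left (Finset.sum_nonneg fun _ _ => gConcurrencePure_nonneg _)

/-- Optimal decompositions for the separate outcomes, together with the complement of the
measurement, form one decomposition of the original reduced state. -/
theorem sum_assistance_sapna_mulVec_le (hd : d ≠ 0) {τ : Type} [Fintype τ] {n' : τ → ℕ}
    (M : ∀ t, Matrix (Fin (n' t)) (Fin n) ℂ) (hM : (1 - ∑ t, (M t)ᴴ * M t).PosSemidef)
    (ψ : Fin d × Fin d × Fin n → ℂ) :
    ∑ t, assistance (((1 : Matrix (Fin d) (Fin d) ℂ) ⊗ₖ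
      ((1 : Matrix (Fin d) (Fin d) ℂ) ⊗ₖ M t)) *ᵥ ψ) ≤ assistance ψ := by
  choose m φ h h' using fun t => exists_assistance_eq hd
    (((1 : Matrix (Fin d) (Fin d) ℂ) ⊗ₖ ((1 : Matrix (Fin d) (Fin d) ℂ) ⊗ₖ M t)) *ᵥ ψ)
  obtain ⟨χ, hχ⟩ := exists_complement_sum_pureState M hM (slice ψ)
  simp only [slice_sapna_mulVec] at h
  have := le_assistance hd (ψ := ψ)
    (Sum.elim (fun x : Σ t, Fin (m t) => φ x.1 x.2) χ) (by
      rw [← hχ]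
      simp only [Fintype.sum_sum_type, Sum.elim_inl, Sum.elim_inr, Fintype.sum_sigma, h])
  simp only [Fintype.sum_sum_type, Sum.elim_inl, Sum.elim_inr, Fintype.sum_sigma, ← h'] at this
  exact (le_add_of_nonneg_right
    (Finset.sum_nonneg fun _ _ => gConcurrencePure_nonneg _)).trans this

end localOperations

/-! ### Kraus operators indexed by outcome and unobserved label -/

section krausOperators

theorem sum_mul_sum_pureState_mul {ι ι' κ τ : Type} [Fintype ι] [Fintype κ] [Fintype τ]
    (T : τ → Matrix ι' ι ℂ) (ψ : κ → ι → ℂ) :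
    ∑ j, T j * (∑ l, pureState (ψ l)) * (T j)ᴴ
      = ∑ x : κ × τ, pureState (T x.2 *ᵥ ψ x.1) := by
  rw [Fintype.sum_prod_type_right]
  simp only [Matrix.mul_sum, Matrix.sum_mul, pureState_mulVec]

variable {c K J : ℕ} {c' : Fin K → ℕ} {M : ∀ k, Fin J → Matrix (Fin (c' k)) (Fin c) ℂ}

theorem IsInstrument.isOperation (hM : IsInstrument M) : IsOperation M := by
  rw [IsOperation, show _ = _ from hM, sub_self]
  exact PosSemidef.zero

theorem IsOperation.posSemidef_prod (hM : IsOperation M) :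
    (1 - ∑ x : Fin K × Fin J, (M x.1 x.2)ᴴ * M x.1 x.2).PosSemidef := by
  rw [Fintype.sum_prod_type]
  exact hM

theorem IsOperation.sum_gramRoot_mul_le {d : ℕ} (hd : d ≠ 0) (hM : IsOperation M)
    (A : Matrix (Fin c) (Fin d) ℂ) : ∑ k, ∑ j, gramRoot (M k j * A) ≤ gramRoot A := by
  have := _root_.sum_gramRoot_mul_le hd (fun x : Fin K × Fin J => M x.1 x.2) hM.posSemidef_prod A
  rwa [Fintype.sum_prod_type] at this

theorem IsOperation.sum_assistance_le {d : ℕ} (hd : d ≠ 0) (hM : IsOperation M)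
    (ψ : Fin d × Fin d × Fin c → ℂ) :
    ∑ k, ∑ j, assistance (((1 : Matrix (Fin d) (Fin d) ℂ) ⊗ₖ
      ((1 : Matrix (Fin d) (Fin d) ℂ) ⊗ₖ M k j)) *ᵥ ψ) ≤ assistance ψ := by
  have := sum_assistance_sapna_mulVec_le hd (fun x : Fin K × Fin J => M x.1 x.2)
    hM.posSemidef_prod ψ
  rwa [Fintype.sum_prod_type] at this

end krausOperators

/-! ### Monotonicity under local operations -/

section monotone

variable {d : ℕ}

theorem isEntanglementMonotone_gAssistance (hd : d ≠ 0) :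
    IsEntanglementMonotone d (fun n => gAssistance (d := d) (n := n)) where
  alice n ρ hρ K J M hM := by
    obtain ⟨m, ψ, hψ, hψ'⟩ := exists_gAssistance_eq hd hρ
    have hk : ∀ k, prob (aliceOp (M k) ρ) * gAssistance (normalized (aliceOp (M k) ρ))
        ≤ ∑ l, ∑ j, gramRoot (M k j) * assistance (ψ l) := fun k => by
      refine (prob_mul_gAssistance_le hd _
        (by rw [hψ, aliceOp, sum_mul_sum_pureState_mul])).trans ?_
      rw [Fintype.sum_prod_type]
      refine Finset.sum_le_sum fun l _ => Finset.sum_le_sum fun j _ => ?_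
      simpa [gramRoot_one] using assistance_local_mulVec_le hd (M k j) 1 (ψ l)
    have hM1 := hM.sum_gramRoot_mul_le hd (1 : Matrix (Fin d) (Fin d) ℂ)
    simp only [Matrix.mul_one, gramRoot_one] at hM1
    refine (Finset.sum_le_sum fun k _ => hk k).trans ?_
    rw [Finset.sum_comm, hψ']
    refine Finset.sum_le_sum fun l _ => ?_
    simp only [← Finset.sum_mul]
    exact mul_le_of_le_one_left (assistance_nonneg _) hM1
  bob n ρ hρ K J M hM := by
    obtain ⟨m, ψ, hψ, hψ'⟩ := exists_gAssistance_eq hd hρ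
    have hk : ∀ k, prob (bobOp (M k) ρ) * gAssistance (normalized (bobOp (M k) ρ))
        ≤ ∑ l, ∑ j, gramRoot (M k j) * assistance (ψ l) := fun k => by
      refine (prob_mul_gAssistance_le hd _
        (by rw [hψ, bobOp, sum_mul_sum_pureState_mul])).trans ?_
      rw [Fintype.sum_prod_type]
      refine Finset.sum_le_sum fun l _ => Finset.sum_le_sum fun j _ => ?_
      simpa [gramRoot_one] using assistance_local_mulVec_le hd 1 (M k j) (ψ l)
    have hM1 := hM.sum_gramRoot_mul_le hd (1 : Matrix (Fin d) (Fin d) ℂ)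
    simp only [Matrix.mul_one, gramRoot_one] at hM1
    refine (Finset.sum_le_sum fun k _ => hk k).trans ?_
    rw [Finset.sum_comm, hψ']
    refine Finset.sum_le_sum fun l _ => ?_
    simp only [← Finset.sum_mul]
    exact mul_le_of_le_one_left (assistance_nonneg _) hM1
  sapna n ρ hρ K J n' M hM := by
    obtain ⟨m, ψ, hψ, hψ'⟩ := exists_gAssistance_eq hd hρ
    have hk := fun k => prob_mul_gAssistance_le hd (ρ := sapnaOp (M k) ρ) _
      (by rw [hψ, sapnaOp, sum_mul_sum_pureState_mul])
    refine (Finset.sum_le_sum fun k _ => hk k).trans ?_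
    simp only [Fintype.sum_prod_type]
    rw [Finset.sum_comm, hψ']
    exact Finset.sum_le_sum fun l _ => hM.sum_assistance_le hd (ψ l)
  convex n := convexOn_gAssistance hd

end monotone

/-! ### Yield of LOCC protocols -/

section LOCC

variable {d a b s K J : ℕ}

theorem LOCC.averageG_finish (ρ : TripartiteOp d d s) :
    (LOCC.finish : LOCC d d d s).averageG ρ
      = prob (reducedAB ρ) * gConcurrence (normalized (reducedAB ρ)) := by
  simp [averageG, outcomes]

theorem LOCC.averageG_alice {a' : Fin K → ℕ} (M : ∀ k, Fin J → Matrix (Fin (a' k)) (Fin a) ℂ)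
    (hM : IsInstrument M) (next : ∀ k, LOCC d (a' k) b s) (ρ : TripartiteOp a b s) :
    (LOCC.alice M hM next).averageG ρ = ∑ k, (next k).averageG (aliceOp (M k) ρ) := by
  simp [averageG, outcomes, List.map_flatten, List.sum_flatten, List.map_ofFn, List.sum_ofFn]

theorem LOCC.averageG_bob {b' : Fin K → ℕ} (M : ∀ k, Fin J → Matrix (Fin (b' k)) (Fin b) ℂ)
    (hM : IsInstrument M) (next : ∀ k, LOCC d a (b' k) s) (ρ : TripartiteOp a b s) :
    (LOCC.bob M hM next).averageG ρ = ∑ k, (next k).averageG (bobOp (M k) ρ) := by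
  simp [averageG, outcomes, List.map_flatten, List.sum_flatten, List.map_ofFn, List.sum_ofFn]

theorem LOCC.averageG_sapna {s' : Fin K → ℕ} (M : ∀ k, Fin J → Matrix (Fin (s' k)) (Fin s) ℂ)
    (hM : IsInstrument M) (next : ∀ k, LOCC d a b (s' k)) (ρ : TripartiteOp a b s) :
    (LOCC.sapna M hM next).averageG ρ = ∑ k, (next k).averageG (sapnaOp (M k) ρ) := by
  simp [averageG, outcomes, List.map_flatten, List.sum_flatten, List.map_ofFn, List.sum_ofFn]

/-- The yield of a protocol on an ensemble of vectors `(Aₗ ⊗ Bₗ ⊗ 1) ψₗ`. The determinants of the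
accumulated operators of Alice and Bob control the protocols with varying local dimensions. -/
theorem LOCC.averageG_le (hd : d ≠ 0) (P : LOCC d a b s) : ∀ {κ : Type} [Fintype κ]
    (A : κ → Matrix (Fin a) (Fin d) ℂ) (B : κ → Matrix (Fin b) (Fin d) ℂ)
    (ψ : κ → Fin d × Fin d × Fin s → ℂ),
    P.averageG (∑ l, pureState ((A l ⊗ₖ (B l ⊗ₖ (1 : Matrix (Fin s) (Fin s) ℂ))) *ᵥ ψ l))
      ≤ ∑ l, gramRoot (A l) * gramRoot (B l) * assistance (ψ l) := by
  induction P with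
  | finish =>
    intro κ _ A B ψ
    rw [averageG_finish]
    refine (prob_mul_sInf_ensembleAverages_le (gConcurrencePure_homogeneous hd)
      gConcurrencePure_nonneg (κ := κ × Fin _)
      (fun x => (A x.1 ⊗ₖ B x.1) *ᵥ slice (ψ x.1) x.2) ?_).trans ?_
    · simp only [reducedAB_sum, reducedAB_pureState, slice_local_mulVec, Fintype.sum_prod_type]
    · rw [Fintype.sum_prod_type]
      refine Finset.sum_le_sum fun l _ => ?_
      simp only [gConcurrencePure_kronecker_mulVec, ← Finset.mul_sum]
      exact mul_le_mul_of_nonneg_left (le_assistance hd _ rfl)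
        (mul_nonneg (gramRoot_nonneg _) (gramRoot_nonneg _))
  | alice M hM next ih =>
    intro κ _ A B ψ
    rw [averageG_alice]
    simp only [aliceOp, sum_mul_sum_pureState_mul, mulVec_mulVec, ← mul_kronecker_mul,
      Matrix.one_mul]
    refine (Finset.sum_le_sum fun k _ => ih k (fun x : κ × Fin _ => M k x.2 * A x.1)
      (fun x => B x.1) fun x => ψ x.1).trans ?_
    simp only [Fintype.sum_prod_type]
    rw [Finset.sum_comm]
    refine Finset.sum_le_sum fun l _ => ?_
    simp only [← Finset.sum_mul]
    exact mul_le_mul_of_nonneg_right (mul_le_mul_of_nonneg_right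
      (hM.isOperation.sum_gramRoot_mul_le hd (A l)) (gramRoot_nonneg _)) (assistance_nonneg _)
  | bob M hM next ih =>
    intro κ _ A B ψ
    rw [averageG_bob]
    simp only [bobOp, sum_mul_sum_pureState_mul, mulVec_mulVec, ← mul_kronecker_mul,
      Matrix.one_mul]
    refine (Finset.sum_le_sum fun k _ => ih k (fun x : κ × Fin _ => A x.1)
      (fun x => M k x.2 * B x.1) fun x => ψ x.1).trans ?_
    simp only [Fintype.sum_prod_type]
    rw [Finset.sum_comm]
    refine Finset.sum_le_sum fun l _ => ?_
    simp only [← Finset.sum_mul, ← Finset.mul_sum]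
    exact mul_le_mul_of_nonneg_right (mul_le_mul_of_nonneg_left
      (hM.isOperation.sum_gramRoot_mul_le hd (B l)) (gramRoot_nonneg _)) (assistance_nonneg _)
  | sapna M hM next ih =>
    intro κ _ A B ψ
    rw [averageG_sapna]
    -- Sapna's operator commutes with those of Alice and Bob, so it can be absorbed into `ψ l`,
    -- where their spaces still have dimension `d`.
    have hswap : ∀ k j l, ((1 : Matrix (Fin _) (Fin _) ℂ) ⊗ₖ
        ((1 : Matrix (Fin _) (Fin _) ℂ) ⊗ₖ M k j)) *ᵥ
          ((A l ⊗ₖ (B l ⊗ₖ (1 : Matrix (Fin _) (Fin _) ℂ))) *ᵥ ψ l)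
        = (A l ⊗ₖ (B l ⊗ₖ (1 : Matrix (Fin _) (Fin _) ℂ))) *ᵥ
          (((1 : Matrix (Fin d) (Fin d) ℂ) ⊗ₖ ((1 : Matrix (Fin d) (Fin d) ℂ) ⊗ₖ M k j)) *ᵥ
            ψ l) := fun k j l => by
      simp only [mulVec_mulVec, ← mul_kronecker_mul, Matrix.one_mul, Matrix.mul_one]
    simp only [sapnaOp, sum_mul_sum_pureState_mul, hswap]
    refine (Finset.sum_le_sum fun k _ => ih k (fun x : κ × Fin _ => A x.1)
      (fun x => B x.1) fun x => ((1 : Matrix (Fin d) (Fin d) ℂ) ⊗ₖ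
        ((1 : Matrix (Fin d) (Fin d) ℂ) ⊗ₖ M k x.2)) *ᵥ ψ x.1).trans ?_
    simp only [Fintype.sum_prod_type]
    rw [Finset.sum_comm]
    refine Finset.sum_le_sum fun l _ => ?_
    simp only [← Finset.mul_sum]
    exact mul_le_mul_of_nonneg_left (hM.isOperation.sum_assistance_le hd (ψ l))
      (mul_nonneg (gramRoot_nonneg _) (gramRoot_nonneg _))

theorem LOCC.averageG_pureState_le (hd : d ≠ 0) (P : LOCC d d d s)
    (ψ : Fin d × Fin d × Fin s → ℂ) : P.averageG (pureState ψ) ≤ assistance ψ := by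
  simpa [gramRoot_one] using P.averageG_le hd (κ := Unit) (fun _ => 1) (fun _ => 1) fun _ => ψ

/-- The ensemble of the optimal decomposition is prepared by a measurement of Sapna. -/
theorem exists_sapna_averageG_eq (hd : d ≠ 0) (ψ : Fin d × Fin d × Fin s → ℂ) :
    ∃ (K s' : ℕ) (M : Fin K → Matrix (Fin s') (Fin s) ℂ)
      (hM : IsInstrument (J := 1) (fun k _ => M k)),
      (LOCC.sapna (d := d) (J := 1) (fun k _ => M k) hM (fun _ => LOCC.finish)).averageG
        (pureState ψ) = assistance ψ := by
  obtain ⟨m, φ, h, h'⟩ := exists_assistance_eq hd ψ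
  obtain ⟨W, hW, hφ⟩ := exists_coisometry_of_sum_pureState_eq _ _ h
  let e : Fin (Fintype.card (Fin s ⊕ Fin m)) ≃ Fin s ⊕ Fin m := (Fintype.equivFin _).symm
  -- Each column of `W` becomes a Kraus operator with one-dimensional output, so that each outcome
  -- leaves Alice and Bob in a pure state; `W * Wᴴ = 1` is the completeness relation.
  have hM : IsInstrument (J := 1) (c' := fun _ => 1)
      fun i _ => Matrix.of fun (_ : Fin 1) k => W k (e i) := by
    rw [IsInstrument]
    ext k k'
    have hWk : ∑ x, W k' x * star (W k x) = if k' = k then 1 else 0 := by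
      simpa [mul_apply, Matrix.one_apply] using congrFun (congrFun hW k') k
    have := e.sum_comp fun x => W k' x * star (W k x)
    rw [hWk] at this
    simp only [Finset.univ_unique, Finset.sum_singleton, Matrix.sum_apply, mul_apply,
      conjTranspose_apply, of_apply, Matrix.one_apply, eq_comm (a := k)]
    rw [← this]
    exact Finset.sum_congr rfl fun i _ => mul_comm _ _
  -- The outcomes in the left summand are extra; nonnegativity suffices for them, as the general
  -- bound on protocols gives the other inequality.
  refine ⟨_, 1, _, hM, le_antisymm (LOCC.averageG_pureState_le hd _ ψ) ?_⟩
  rw [LOCC.averageG_sapna]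
  have hk : ∀ i, (LOCC.finish : LOCC d d d 1).averageG
      (sapnaOp (fun _ : Fin 1 => Matrix.of fun (_ : Fin 1) k => W k (e i)) (pureState ψ))
      = gConcurrencePure (∑ k, W k (e i) • slice ψ k) := fun i => by
    rw [LOCC.averageG_finish, sapnaOp]
    simp only [Finset.univ_unique, Finset.sum_singleton]
    rw [← pureState_mulVec, reducedAB_pureState]
    simp only [Finset.univ_unique, Finset.sum_singleton, slice_sapna_mulVec, of_apply]
    exact prob_mul_sInf_ensembleAverages_pureState (gConcurrencePure_homogeneous hd) _
  simp only [hk]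
  rw [e.sum_comp fun x => gConcurrencePure (∑ k, W k x • slice ψ k), Fintype.sum_sum_type, h']
  simp only [← hφ]
  exact le_add_of_nonneg_left (Finset.sum_nonneg fun _ _ => gConcurrencePure_nonneg _)

theorem isGreatest_averageG (hd : d ≠ 0) (ψ : Fin d × Fin d × Fin s → ℂ) :
    IsGreatest (Set.range fun P : LOCC d d d s => P.averageG (pureState ψ)) (assistance ψ) := by
  obtain ⟨K, s', M, hM, h⟩ := exists_sapna_averageG_eq hd ψ
  refine ⟨⟨_, h⟩, ?_⟩
  rintro _ ⟨P, rfl⟩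
  exact P.averageG_pureState_le hd ψ

end LOCC

/-! ### Exclusion of dimension zero, and the theorem -/

theorem IsUnitVector.left_dim_ne_zero {d n : ℕ} {ψ : Fin d × Fin d × Fin n → ℂ}
    (hψ : IsUnitVector ψ) : d ≠ 0 := by
  rintro rfl
  simp [IsUnitVector] at hψ

theorem not_isState_of_isEmpty {ι : Type} [Fintype ι] [IsEmpty ι] (ρ : Matrix ι ι ℂ) :
    ¬ IsState ρ := fun h => by
  simpa [Matrix.trace] using h.2

end AssistedConcurrence

theorem theorem1 (d : ℕ) :
    -- the maxima and minima in the definitions are attained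
    (∀ σ : BipartiteOp d d, IsState σ →
      IsLeast (ensembleAverages gConcurrencePure σ) (gConcurrence σ)) ∧
    (∀ (n : ℕ) (ψ : Fin d × Fin d × Fin n → ℂ), IsUnitVector ψ →
      IsGreatest (ensembleAverages gConcurrencePure (reducedAB (pureState ψ)))
        (gAssistancePure ψ)) ∧
    (∀ (n : ℕ) (ρ : TripartiteOp d d n), IsState ρ →
      IsLeast (ensembleAverages gAssistancePure ρ) (gAssistance ρ)) ∧
    -- the convex roof extends the function on pure states
    (∀ (n : ℕ) (ψ : Fin d × Fin d × Fin n → ℂ), IsUnitVector ψ →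
      gAssistance (pureState ψ) = gAssistancePure ψ) ∧
    -- the G-concurrence of assistance is an entanglement monotone
    IsEntanglementMonotone d (fun n => gAssistance (d := d) (n := n)) ∧
    -- on pure states it is the assisted G-concurrence, which is attained
    -- by a single measurement of Sapna
    (∀ (n : ℕ) (ψ : Fin d × Fin d × Fin n → ℂ), IsUnitVector ψ →
      assistedG (pureState ψ) = gAssistancePure ψ ∧
      IsGreatest (Set.range fun P : LOCC d d d n => P.averageG (pureState ψ))
        (assistedG (pureState ψ)) ∧
      ∃ (K s' : ℕ) (M : Fin K → Matrix (Fin s') (Fin n) ℂ)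
        (hM : IsInstrument (J := 1) (fun k _ => M k)),
        (LOCC.sapna (d := d) (J := 1) (fun k _ => M k) hM (fun _ => LOCC.finish)).averageG
          (pureState ψ) = assistedG (pureState ψ)) := by
  have hd2 : ∀ {σ : BipartiteOp d d}, IsState σ → d ≠ 0 := by
    rintro σ hσ rfl
    exact not_isState_of_isEmpty σ hσ
  have hd3 : ∀ {n : ℕ} {ρ : TripartiteOp d d n}, IsState ρ → d ≠ 0 := by
    rintro n ρ hρ rfl
    exact not_isState_of_isEmpty ρ hρ
  refine ⟨fun σ hσ => ?_, fun n ψ hψ => ?_, fun n ρ hρ => ?_, fun n ψ hψ => ?_, ?_,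
    fun n ψ hψ => ?_⟩
  · have hd := hd2 hσ
    refine isLeast_sInf_ensembleAverages (gConcurrencePure_homogeneous hd)
      (continuous_gConcurrencePure hd).lowerSemicontinuous (C := 1) (fun φ hφ => ?_) hσ
    rw [abs_of_nonneg (gConcurrencePure_nonneg φ)]
    exact (gConcurrencePure_le_prob φ).trans (isUnitVector_iff.1 hφ).le
  · have hd := hψ.left_dim_ne_zero
    rw [ensembleAverages_reducedAB hd hψ, gAssistancePure_eq hd hψ]
    exact isGreatest_assistance hd ψ
  · have hd := hd3 hρ
    rw [ensembleAverages_gAssistancePure hd]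
    exact isLeast_gAssistance hd hρ
  · have hd := hψ.left_dim_ne_zero
    rw [gAssistance_eq hd, ensembleAverages_pureState (assistance_homogeneous hd) hψ,
      csInf_singleton, gAssistancePure_eq hd hψ]
  -- The homogeneity of `gramRoot` needs `d ≠ 0`; for `d = 0` there are no states and every clause
  -- is vacuous.
  · by_cases hd : d = 0
    · exact ⟨fun n ρ hρ => absurd hd (hd3 hρ), fun n ρ hρ => absurd hd (hd3 hρ),
        fun n ρ hρ => absurd hd (hd3 hρ), fun n =>
          ⟨fun ρ hρ => absurd hd (hd3 hρ), fun ρ hρ => absurd hd (hd3 hρ)⟩⟩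
    · exact isEntanglementMonotone_gAssistance hd
  · have hd := hψ.left_dim_ne_zero
    have hmax := isGreatest_averageG hd ψ
    have heq : assistedG (pureState ψ) = assistance ψ := hmax.csSup_eq
    rw [heq]
    exact ⟨(gAssistancePure_eq hd hψ).symm, hmax, exists_sapna_averageG_eq hd ψ⟩
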